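/- **Setting.** Let $\mathbb G=\bigsqcup_{n\ge 0}S_n$ be a set partitioned into finite shells $S_n$, and let $H=(h(x,y))_{x,y\in\mathbb G}$ be a Hermitian matrix with $h(x,y)=0$ whenever $x\in S_j$, $y\in S_k$, $|j-k|\ge 2$. Let $H_{\min}$ be the operator on $\ell^2(\mathbb G)$ given by $H$ on the finitely supported vectors; assume that $H_{\min}$ is essentially self-adjoint, and write $H=H_{\min}^*$ for the resulting self-adjoint operator. Let $W_{n+1}$ be the block of $H$ from $\ell^2(S_n)$ to $\ell^2(S_{n+1})$; put $r_0=1$ and $r_n=\operatorname{rank}W_n$ for $n\ge1$. For each $n\geq 0$ fix a factorization $W_{n+1}=-\Upsilon_{n+1}\Phi_n^*$ with full rank matrices $\Upsilon_{n+1}\in\mathbb C^{S_{n+1}\times r_{n+1}}$, $\Phi_n\in\mathbb C^{S_n\times r_{n+1}}$, and fix a non-zero root vector $\Upsilon_0\in\ell^2(S_0)$. For $m\le n$ let $H_{m,n}$ be the restriction of $H$ to $\ell^2(S_m\sqcup\dots\sqcup S_n)$, regard the columns of $\Upsilon_m$ and $\Phi_n$ as vectors in this space, and for $z\notin\sigma(H_{m,n})$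 set $$\begin{pmatrix}\alpha^z_{m,n}&\beta^z_{m,n}\\ \gamma^z_{m,n}&\delta^z_{m,n}\end{pmatrix}=\begin{pmatrix}\Upsilon_m^*\\ \Phi_n^*\end{pmatrix}(H_{m,n}-z)^{-1}\begin{pmatrix}\Upsilon_m&\Phi_n\end{pmatrix},$$ $$\mathbb T^z_{m,n}=\left\{\begin{pmatrix}B&-\mathfrak b\\ \delta^z_{m,n}B&\gamma^z_{m,n}-\delta^z_{m,n}\mathfrak b\end{pmatrix}: B,\mathfrak b\in\mathbb C^{r_{n+1}\times r_m},\ \beta^z_{m,n}B=\mathbf 1,\ \beta^z_{m,n}\mathfrak b=\alpha^z_{m,n}\right\}.$$ Assume (A1) $r_{n+1}\ge r_n$ for all $n\ge0$, and (A2) for every $n$ and almost every $\lambda\in\mathbb R$ the matrix $\beta^\lambda_{n,n}$ has rank $r_n$. Let $\mu$ be the spectral measure of $H$ at the root vector $\Upsilon_0$ (extended by zero to an element of $\ell^2(\mathbb G)$), $\mu_{ac}$ its absolutely continuous part, and $\sigma_{ac}(H)$ the absolutely continuous spectrum of $H$, i.e. the spectrum of the restriction of $H$ to its absolutely continuous subspace.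 Let $a<b$ be real numbers. By a measurable choice $\lambda\mapsto T^\lambda_{0,n}\in\mathbb T^\lambda_{0,n}$ we mean a measurable matrix-valued function on $(a,b)$ with $T^\lambda_{0,n}\in\mathbb T^\lambda_{0,n}$ for almost every $\lambda\in(a,b)$; norms of vectors are Euclidean. **Theorem.** (i) Suppose that for some strictly increasing sequence $(n_k)_k$ there are measurable choices $\lambda\mapsto T^\lambda_{0,n_k}\in\mathbb T^\lambda_{0,n_k}$ such that $$\sup_k\left\|T^\lambda_{0,n_k}\begin{pmatrix}1\\0\end{pmatrix}\right\|<\infty\quad\text{for Lebesgue almost every }\lambda\in(a,b).$$ Then $[a,b]\subset\operatorname{supp}\mu_{ac}\subset\sigma_{ac}(H)$. (ii) Suppose that there are an almost everywhere positive function $w\in L^1_{loc}(a,b)$ and measurable choices $\lambda\mapsto T^\lambda_{0,n}\in\mathbb T^\lambda_{0,n}$, $n\ge0$, such that for every compact set $K\subset(a,b)$ of positive Lebesgue measure $$\liminf_{n\to\infty}\int_K\log\left(\left\|T^\lambda_{0,n}\begin{pmatrix}1\\0\end{pmatrix}\right\|\,w(\lambda)\right)w(\lambda)\,d\lambda<\infty,$$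 where the integrals take values in $[-\infty,\infty]$. Then $[a,b]\subset\operatorname{supp}\mu_{ac}\subset\sigma_{ac}(H)$. -/

import Mathlib

open scoped ENNReal
open MeasureTheory Filter Matrix

noncomputable section

/-! ### Spectral theory of (unbounded) operators on a complex Hilbert space -/

section Spectral

variable {E : Type*} [NormedAddCommGroup E] [InnerProductSpace ℂ E]

/-- `μ` is the spectral measure of the self-adjoint operator `A` at the vector `φ`: a finite Borel
measure on `ℝ` with `⟪φ, (A - z)⁻¹ φ⟫ = ∫ (x - z)⁻¹ dμ(x)` for all non-real `z`. The vector
`(A - z)⁻¹ φ` is written as a `ψ` in the domain of `A` with `(A - z) ψ = φ`. -/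
def IsSpectralMeasure (A : E →ₗ.[ℂ] E) (φ : E) (μ : Measure ℝ) : Prop :=
  IsFiniteMeasure μ ∧ ∀ z : ℂ, z.im ≠ 0 →
    ∃ ψ : A.domain, A ψ - z • (ψ : E) = φ ∧
      inner ℂ φ (ψ : E) = ∫ x : ℝ, ((x : ℂ) - z)⁻¹ ∂μ

open Classical in
/-- The spectral measure of `A` at `φ` (and `0` if there is none, which does not happen for a
self-adjoint `A`). -/
def spectralMeasure (A : E →ₗ.[ℂ] E) (φ : E) : Measure ℝ :=
  if h : ∃ μ, IsSpectralMeasure A φ μ then h.choose else 0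

/-- The absolutely continuous subspace: all vectors whose spectral measure is absolutely
continuous with respect to Lebesgue measure. -/
def acSubspace (A : E →ₗ.[ℂ] E) : Set E :=
  {ψ | ∃ μ, IsSpectralMeasure A ψ μ ∧ μ ≪ volume}

/-- `t` belongs to the resolvent set of the restriction of `A` to its absolutely continuous
subspace: `A - t` maps `D(A) ∩ E_ac` onto `E_ac`, injectively and with bounded inverse. -/
def IsAcResolventPoint (A : E →ₗ.[ℂ] E) (t : ℝ) : Prop :=
  (∀ η ∈ acSubspace A, ∃ ψ : A.domain, (ψ : E) ∈ acSubspace A ∧ A ψ - (t : ℂ) • (ψ : E) = η) ∧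
  ∃ C : ℝ, ∀ ψ : A.domain, (ψ : E) ∈ acSubspace A → ‖(ψ : E)‖ ≤ C * ‖A ψ - (t : ℂ) • (ψ : E)‖

/-- The absolutely continuous spectrum of `A`: the spectrum of the restriction of `A` to its
absolutely continuous subspace. -/
def acSpectrum (A : E →ₗ.[ℂ] E) : Set ℝ := {t | ¬ IsAcResolventPoint A t}

end Spectral

/-- The absolutely continuous part of a measure on `ℝ` in its Lebesgue decomposition. -/
def acPart (μ : Measure ℝ) : Measure ℝ := volume.withDensity (μ.rnDeriv volume)

/-- The integral over `K` with respect to Lebesgue measure with values in `[-∞, ∞]`: the integral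
of the positive part minus the integral of the negative part. -/
def extIntegral (K : Set ℝ) (f : ℝ → ℝ) : EReal :=
  ((∫⁻ t in K, ENNReal.ofReal (f t) : ℝ≥0∞) : EReal) -
    ((∫⁻ t in K, ENNReal.ofReal (-f t) : ℝ≥0∞) : EReal)

/-! ### Hermitian operators with a quasi-spherical partition -/

/-- A Hermitian matrix indexed by the set `𝔾`, with entries `h x y = ⟨δ_x, H δ_y⟩`, together with a
quasi-spherical partition of `𝔾` into finite shells `S n = {x | shell x = n}`: only points in the
same or in neighbouring shells are connected. In particular `h` has locally finite hopping. -/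
structure ShellOperator (𝔾 : Type*) where
  h : Matrix 𝔾 𝔾 ℂ
  hermitian : h.IsHermitian
  shell : 𝔾 → ℕ
  finite_shell : ∀ n, {x | shell x = n}.Finite
  hopping : ∀ x y, shell x + 2 ≤ shell y ∨ shell y + 2 ≤ shell x → h x y = 0

namespace ShellOperator

variable {𝔾 : Type*} (D : ShellOperator 𝔾)

/-- The `n`-th shell. -/
abbrev S (n : ℕ) : Type _ := {x : 𝔾 // D.shell x = n}

/-- The union of the shells `m, …, n`. -/
abbrev G (m n : ℕ) : Type _ := {x : 𝔾 // m ≤ D.shell x ∧ D.shell x ≤ n}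

theorem finite_shells_le (n : ℕ) : {x | D.shell x ≤ n}.Finite := by
  have : {x | D.shell x ≤ n} = ⋃ k ∈ Set.Iic n, {x | D.shell x = k} := by
    ext x; simp
  rw [this]
  exact (Set.finite_Iic n).biUnion fun k _ => D.finite_shell k

instance (n : ℕ) : Fintype (D.S n) := (D.finite_shell n).fintype

instance (m n : ℕ) : Fintype (D.G m n) :=
  ((D.finite_shells_le n).subset fun _ hx => hx.2 :
    {x | m ≤ D.shell x ∧ D.shell x ≤ n}.Finite).fintype

instance (m n : ℕ) : DecidableEq (D.G m n) := Classical.decEq _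

theorem finite_col (y : 𝔾) : {x | D.h x y ≠ 0}.Finite := by
  refine (D.finite_shells_le (D.shell y + 1)).subset fun x hx => ?_
  by_contra hlt
  exact hx (D.hopping x y (Or.inr (by simp only [Set.mem_ofPred_eq] at hlt; omega)))

/-- The Hilbert space `ℓ²(𝔾)`. -/
abbrev HilbertSpace (𝔾 : Type*) : Type _ := lp (fun _ : 𝔾 => ℂ) 2

/-- The finitely supported vectors in `ℓ²(𝔾)`. -/
def compactlySupported (𝔾 : Type*) : Submodule ℂ (HilbertSpace 𝔾) where
  carrier := {ψ | {x | ψ x ≠ 0}.Finite}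
  add_mem' := by
    intro f g hf hg
    refine (hf.union hg).subset fun x hx => ?_
    by_contra hn
    simp only [Set.mem_union, Set.mem_ofPred_eq, not_or, not_not] at hn
    exact hx (by simp [hn.1, hn.2])
  zero_mem' := by simp
  smul_mem' := by
    intro c f hf
    refine Set.Finite.subset hf fun x hx h0 => hx ?_
    simp [h0]

/-- The action `(H ψ)(x) = ∑_y h x y ψ(y)` on functions (a finite sum by local finiteness). -/
def act (ψ : 𝔾 → ℂ) (x : 𝔾) : ℂ := ∑ᶠ y, D.h x y * ψ y

theorem finite_support_act {ψ : 𝔾 → ℂ} (hψ : {x | ψ x ≠ 0}.Finite) :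
    {x | D.act ψ x ≠ 0}.Finite := by
  refine (hψ.biUnion fun y _ => D.finite_col y).subset fun x hx => ?_
  by_contra hn
  simp only [Set.mem_iUnion, Set.mem_ofPred_eq, not_exists, not_not] at hn
  refine hx (finsum_eq_zero_of_forall_eq_zero fun y => ?_)
  by_cases hy : ψ y = 0
  · simp [hy]
  · simp [hn y hy]

theorem finite_mul {ψ : 𝔾 → ℂ} (hψ : {x | ψ x ≠ 0}.Finite) (x : 𝔾) :
    (Function.support fun y => D.h x y * ψ y).Finite :=
  hψ.subset fun _ hy h0 => hy (by simp [h0])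

/-- The minimal operator `H_min`: the action of `H` on the finitely supported vectors. -/
def Hmin : HilbertSpace 𝔾 →ₗ.[ℂ] HilbertSpace 𝔾 where
  domain := compactlySupported 𝔾
  toFun :=
    { toFun := fun ψ => ⟨D.act ψ.1,
        (memℓp_zero (D.finite_support_act ψ.2)).of_exponent_ge (zero_le)⟩
      map_add' := by
        intro f g
        ext x
        have := finsum_add_distrib (D.finite_mul f.2 x) (D.finite_mul g.2 x)
        change D.act (f.1 + g.1 : HilbertSpace 𝔾) x = D.act f.1 x + D.act g.1 x
        simpa [act, mul_add] using this
      map_smul' := by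
        intro c f
        ext x
        have := (smul_finsum c fun y => D.h x y * f.1 y).symm
        simpa [act, mul_left_comm] using this }

/-- The operator `H = H_min^*`, whose domain is the natural domain `{ψ ∈ ℓ² | H ψ ∈ ℓ²}`. -/
def H : HilbertSpace 𝔾 →ₗ.[ℂ] HilbertSpace 𝔾 := D.Hmin.adjoint

/-- `H` is self-adjoint with its natural domain: `H_min` is essentially self-adjoint, that is, its
closure is self-adjoint. -/
def SelfAdjointWithNaturalDomain : Prop := IsSelfAdjoint D.Hmin.closure

/-- `D.W n` is the connection matrix `W_{n+1} = P_{n+1}^* H P_n`. -/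
def W (n : ℕ) : Matrix (D.S (n + 1)) (D.S n) ℂ := D.h.submatrix (↑) (↑)

/-- The ranks: `r_0 = 1` and `r_n = rank W_n` for `n ≥ 1`. -/
def r : ℕ → ℕ
  | 0 => 1
  | n + 1 => (D.W n).rank

/-- The restriction `H_{m,n}` of `H` to the shells `m, …, n`. -/
def Hpart (m n : ℕ) : Matrix (D.G m n) (D.G m n) ℂ := D.h.submatrix (↑) (↑)

/-- Full rank factorizations `W_{n+1} = -Υ_{n+1} Φ_n^*` of all connection matrices, together with a
non-zero root vector `Υ_0 ∈ ℓ²(S_0)` (an `s_0 × 1` matrix of rank `1`). -/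
structure Channels where
  Υ : ∀ n, Matrix (D.S n) (Fin (D.r n)) ℂ
  Φ : ∀ n, Matrix (D.S n) (Fin (D.r (n + 1))) ℂ
  factor : ∀ n, D.W n = -(Υ (n + 1) * (Φ n)ᴴ)
  rank_Υ : ∀ n, (Υ n).rank = D.r n
  rank_Φ : ∀ n, (Φ n).rank = D.r (n + 1)

namespace Channels

variable {D} (c : D.Channels)

open Classical in
/-- `P_{m,n}^* P_m Υ_m`, the columns of `Υ_m` as vectors in `ℓ²(𝔾_{m,n})`. -/
def embΥ (m n : ℕ) : Matrix (D.G m n) (Fin (D.r m)) ℂ :=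
  Matrix.of fun x j => if hx : D.shell x.1 = m then c.Υ m ⟨x.1, hx⟩ j else 0

open Classical in
/-- `P_{m,n}^* P_n Φ_n`, the columns of `Φ_n` as vectors in `ℓ²(𝔾_{m,n})`. -/
def embΦ (m n : ℕ) : Matrix (D.G m n) (Fin (D.r (n + 1))) ℂ :=
  Matrix.of fun x j => if hx : D.shell x.1 = n then c.Φ n ⟨x.1, hx⟩ j else 0

/-- The boundary resolvent data `R^z_{m,n}` for `z` outside the finite spectrum of `H_{m,n}`.
(For `z` in the spectrum the matrix inverse is a junk value; `R^z_{m,n}` is used below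
only for Lebesgue almost every real `z`.) -/
def R (m n : ℕ) (z : ℂ) :
    Matrix (Fin (D.r m) ⊕ Fin (D.r (n + 1))) (Fin (D.r m) ⊕ Fin (D.r (n + 1))) ℂ :=
  (fromCols (c.embΥ m n) (c.embΦ m n))ᴴ * (D.Hpart m n - z • 1)⁻¹ *
    fromCols (c.embΥ m n) (c.embΦ m n)

def α (m n : ℕ) (z : ℂ) : Matrix (Fin (D.r m)) (Fin (D.r m)) ℂ := (c.R m n z).toBlocks₁₁

def β (m n : ℕ) (z : ℂ) : Matrix (Fin (D.r m)) (Fin (D.r (n + 1))) ℂ := (c.R m n z).toBlocks₁₂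

def γ (m n : ℕ) (z : ℂ) : Matrix (Fin (D.r (n + 1))) (Fin (D.r m)) ℂ := (c.R m n z).toBlocks₂₁

def δ (m n : ℕ) (z : ℂ) : Matrix (Fin (D.r (n + 1))) (Fin (D.r (n + 1))) ℂ :=
  (c.R m n z).toBlocks₂₂

/-- The set `𝕋^z_{m,n}` of transfer matrices. -/
def transferSet (m n : ℕ) (z : ℂ) :
    Set (Matrix (Fin (D.r (n + 1)) ⊕ Fin (D.r (n + 1))) (Fin (D.r m) ⊕ Fin (D.r m)) ℂ) :=
  {T | ∃ B b : Matrix (Fin (D.r (n + 1))) (Fin (D.r m)) ℂ,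
    c.β m n z * B = 1 ∧ c.β m n z * b = c.α m n z ∧
    T = fromBlocks B (-b) (c.δ m n z * B) (c.γ m n z - c.δ m n z * b)}

/-- Assumption (A2): for all `n` and almost all real `t`, `β^t_n` has full rank `r_n`. -/
def FullRank : Prop := ∀ n, ∀ᵐ t : ℝ, (c.β n n (t : ℂ)).rank = D.r n

open Classical in
/-- The root vector `P_0 Υ_0 ∈ ℓ²(𝔾)`. -/
def root : HilbertSpace 𝔾 :=
  ⟨fun x => if hx : D.shell x = 0 then c.Υ 0 ⟨x, hx⟩ (0 : Fin 1) else 0,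
    (memℓp_zero ((D.finite_shell 0).subset fun x hx => by
      by_contra hn
      exact hx (dif_neg hn))).of_exponent_ge (zero_le)⟩

/-- The spectral measure `μ` of `H` at the root vector. -/
def μ : Measure ℝ := spectralMeasure D.H c.root

end Channels

/-- Assumption (A1): the ranks are non-decreasing. -/
def RankMonotone : Prop := ∀ n, D.r n ≤ D.r (n + 1)

/-- The Euclidean norm of `T (1, 0)ᵀ` for a `2 r_{n+1} × 2` matrix `T` (note that `r_0 = 1`). -/
def normDirichlet {n : ℕ}
    (T : Matrix (Fin (D.r (n + 1)) ⊕ Fin (D.r (n + 1))) (Fin (D.r 0) ⊕ Fin (D.r 0)) ℂ) : ℝ :=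
  ‖WithLp.toLp 2 (T *ᵥ Sum.elim (fun _ => 1) (fun _ => 0))‖

/-- `T` is a measurable choice `t ↦ T t ∈ 𝕋^t_{0,n}`, defined for almost every `t ∈ (a, b)`. -/
def Channels.IsMeasurableChoice {D : ShellOperator 𝔾} (c : D.Channels) (a b : ℝ) (n : ℕ)
    (T : ℝ → Matrix (Fin (D.r (n + 1)) ⊕ Fin (D.r (n + 1))) (Fin (D.r 0) ⊕ Fin (D.r 0)) ℂ) :
    Prop :=
  (∀ i j, AEMeasurable (fun t => T t i j) (volume.restrict (Set.Ioo a b))) ∧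
  ∀ᵐ t : ℝ ∂(volume.restrict (Set.Ioo a b)), T t ∈ c.transferSet 0 n (t : ℂ)

end ShellOperator

end

open scoped Topology NNReal ComplexConjugate

noncomputable section

/-! The spectral measure `μ` is approximated by measures with explicit densities. Adding the
dissipative boundary term `-i Φ_n Φ_n^*` to the truncation `H_{0,n}` gives functions `m_n(z) = Υ_0^*
(H_{0,n} - i Φ_n Φ_n^* - z)⁻¹ Υ_0` that are holomorphic with non-negative imaginary part in the
upper half plane, with the uniform bound `‖Υ_0‖² / Im z`. For almost every real `t` they have the
boundary density `ρ_n(t) = Im m_n(t) = ‖Φ_n^* (H_{0,n} - i Φ_n Φ_n^* - t)⁻¹ Υ_0‖²`. Since finitely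
supported vectors form a core for `H`, and the boundary term does not see such a vector once `n` is
large, `m_n(z)` converges to the Stieltjes transform of `μ` (`tendsto_truncatedM`).

Transfer matrices enter through a Cauchy-Schwarz inequality: every `T` in the transfer set satisfies
`ρ_n(t) ‖T (1,0)ᵀ‖² ≥ 1` (`one_le_im_dissipativeM_mul`, `one_le_density_mul`). Bounded solutions
thus bound the densities from below. On the other hand, convergence of the Stieltjes transforms and
the Poisson formula show that `∫_K ρ_n → 0` on every compact set `K` with `μ K = 0`
(`tendsto_lintegral_boundary_zero`).

These facts are incompatible on a compact set of positive Lebesgue measure: in (i) by Fatou's lemma,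
in (ii) because `log x ≤ x - 1` turns small `∫_K ρ_n` into arbitrarily large logarithmic integrals
(`log_mul_mul_ge`). So `μ` charges every compact subset of `(a, b)` of positive Lebesgue measure.
Choosing such sets where `μ` coincides with its absolutely continuous part gives `[a, b] ⊆ supp
μ_ac` (`Icc_subset_support_acPart`). The inclusion in the absolutely continuous spectrum follows
from the spectral theorem: near a point of `supp μ_ac`, spectral projections of the root vector are
approximate eigenvectors in the absolutely continuous subspace. -/

/-! ### The Poisson kernel of the upper half plane -/

/-- The Poisson kernel of the upper half plane at height `y`. -/
def halfPlanePoisson (y s : ℝ) : ℝ := Real.pi⁻¹ * (y / (s ^ 2 + y ^ 2))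

theorem halfPlanePoisson_nonneg {y : ℝ} (hy : 0 ≤ y) (s : ℝ) : 0 ≤ halfPlanePoisson y s := by
  unfold halfPlanePoisson; positivity

theorem halfPlanePoisson_neg (y s : ℝ) : halfPlanePoisson y (-s) = halfPlanePoisson y s := by
  simp [halfPlanePoisson]

theorem continuous_halfPlanePoisson {y : ℝ} (hy : 0 < y) : Continuous (halfPlanePoisson y) := by
  unfold halfPlanePoisson
  refine continuous_const.mul (continuous_const.div (by fun_prop) fun s => ?_)
  positivity

theorem halfPlanePoisson_eq {y : ℝ} (hy : 0 < y) (s : ℝ) :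
    halfPlanePoisson y s = y⁻¹ * (Real.pi⁻¹ * (1 + (y⁻¹ * s) ^ 2)⁻¹) := by
  unfold halfPlanePoisson
  field_simp
  ring

theorem halfPlanePoisson_mul {y : ℝ} (hy : 0 < y) (s : ℝ) :
    halfPlanePoisson y (y * s) = y⁻¹ * halfPlanePoisson 1 s := by
  unfold halfPlanePoisson
  field_simp

theorem halfPlanePoisson_le {y : ℝ} (hy : 0 < y) (s : ℝ) : halfPlanePoisson y s ≤ y⁻¹ := by
  rw [halfPlanePoisson_eq hy]
  refine mul_le_of_le_one_right (by positivity) (mul_le_one₀ ?_ (by positivity) ?_)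
  · exact inv_le_one_of_one_le₀ (by linarith [Real.pi_gt_three])
  · exact inv_le_one_of_one_le₀ (by nlinarith [sq_nonneg (y⁻¹ * s)])

theorem integrable_halfPlanePoisson {y : ℝ} (hy : 0 < y) :
    Integrable (halfPlanePoisson y) := by
  have h := ((integrable_inv_one_add_sq.comp_mul_left' (inv_ne_zero hy.ne')).const_mul
    Real.pi⁻¹).const_mul y⁻¹
  refine h.congr (Eventually.of_forall fun s => ?_)
  simp [halfPlanePoisson_eq hy]

theorem integral_halfPlanePoisson {y : ℝ} (hy : 0 < y) : ∫ s, halfPlanePoisson y s = 1 := by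
  simp_rw [halfPlanePoisson_eq hy]
  rw [integral_const_mul, integral_const_mul,
    Measure.integral_comp_mul_left (fun s : ℝ => (1 + s ^ 2)⁻¹) y⁻¹, integral_univ_inv_one_add_sq]
  rw [inv_inv, abs_of_pos hy, smul_eq_mul]
  field_simp

theorem integrable_halfPlanePoisson_sub {y : ℝ} (hy : 0 < y) (x : ℝ) :
    Integrable fun t => halfPlanePoisson y (x - t) :=
  (integrable_halfPlanePoisson hy).comp_sub_left x

theorem integral_halfPlanePoisson_sub {y : ℝ} (hy : 0 < y) (x : ℝ) :
    ∫ t, halfPlanePoisson y (x - t) = 1 := by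
  rw [integral_sub_left_eq_self (halfPlanePoisson y) volume x, integral_halfPlanePoisson hy]

theorem im_inv_sub_eq_halfPlanePoisson (x t y : ℝ) :
    (((x : ℂ) - (t + y * Complex.I))⁻¹).im = Real.pi * halfPlanePoisson y (t - x) := by
  have : Complex.normSq ((x : ℂ) - (t + y * Complex.I)) = (t - x) ^ 2 + y ^ 2 := by
    simp [Complex.normSq_apply]; ring
  rw [Complex.inv_im, this]
  simp only [halfPlanePoisson, Complex.sub_im, Complex.ofReal_im, Complex.add_im, Complex.mul_im,
    Complex.ofReal_re, Complex.I_im, Complex.I_re]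
  field_simp [Real.pi_ne_zero]
  ring

/-- The integral along the real line of a function that is holomorphic near the closed upper half
plane and decays like `|ζ|⁻²` vanishes. -/
theorem integral_eq_zero_of_decay {F : ℂ → ℂ} {M R₀ : ℝ}
    (hF : ∀ z : ℂ, 0 ≤ z.im → DifferentiableAt ℂ F z)
    (hb : ∀ z : ℂ, 0 ≤ z.im → R₀ ≤ ‖z‖ → ‖F z‖ ≤ M / ‖z‖ ^ 2)
    (hi : Integrable fun t : ℝ => F t) : ∫ t : ℝ, F t = 0 := by
  have h1 : Tendsto (fun R : ℝ => ∫ t in (-R)..R, F t) atTop (𝓝 (∫ t : ℝ, F t)) :=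
    intervalIntegral_tendsto_integral hi tendsto_neg_atTop_atBot tendsto_id
  have h2 : Tendsto (fun R : ℝ => ∫ t in (-R)..R, F t) atTop (𝓝 0) := by
    -- Cauchy's theorem on the square `[-R, R] × [0, R]`: the three sides off the real line have
    -- total length `4 R`, and `F` is at most `|M| / R ^ 2` there.
    have h3 : Tendsto (fun R : ℝ => 4 * |M| / R) atTop (𝓝 0) :=
      tendsto_const_nhds.div_atTop tendsto_id
    refine squeeze_zero_norm' ?_ h3
    filter_upwards [eventually_ge_atTop (max R₀ 1)] with R hR
    have hR0 : R₀ ≤ R := (le_max_left _ _).trans hR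
    have hRp : 0 < R := lt_of_lt_of_le one_pos ((le_max_right _ _).trans hR)
    have key := Complex.integral_boundary_rect_eq_zero_of_differentiableOn F (-R : ℝ)
      ((R : ℝ) + R * Complex.I) (fun z hz => by
        refine (hF z ?_).differentiableWithinAt
        have h := hz.2
        simp only [Set.mem_preimage, Complex.ofReal_im, Complex.add_im, Complex.mul_im,
          Complex.ofReal_re, Complex.I_im, Complex.I_re] at h
        rw [Set.uIcc_of_le (by linarith)] at h
        exact h.1)
    simp only [Complex.ofReal_im, Complex.add_im, Complex.mul_im, Complex.add_re, Complex.mul_re,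
      Complex.ofReal_re, Complex.I_im, Complex.I_re, mul_zero, mul_one, zero_add, add_zero,
      sub_zero, zero_mul, Complex.ofReal_zero] at key
    have bd : ∀ z : ℂ, 0 ≤ z.im → R ≤ ‖z‖ → ‖F z‖ ≤ |M| / R ^ 2 := by
      intro z hz hzR
      refine (hb z hz (hR0.trans hzR)).trans ?_
      gcongr
      exact le_abs_self M
    have e1 : ‖∫ x in (-R)..R, F (x + R * Complex.I)‖ ≤ |M| / R ^ 2 * |R - -R| := by
      refine intervalIntegral.norm_integral_le_of_norm_le_const fun x _ => bd _ (by simpa using hRp.le) ?_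
      have := Complex.abs_im_le_norm ((x : ℂ) + R * Complex.I)
      simp only [Complex.add_im, Complex.ofReal_im, Complex.mul_im, Complex.ofReal_re,
        Complex.I_im, Complex.I_re] at this
      rw [show 0 + (R * 1 + 0 * 0) = R by ring, abs_of_pos hRp] at this
      exact this
    have e2 : ∀ s : ℝ, |s| = R → ‖∫ y in (0 : ℝ)..R, F (s + y * Complex.I)‖ ≤ |M| / R ^ 2 * |R - 0| := by
      intro s hs
      refine intervalIntegral.norm_integral_le_of_norm_le_const fun y hy => bd _ ?_ ?_
      · rw [Set.uIoc_of_le hRp.le] at hy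
        simpa using hy.1.le
      · have := Complex.abs_re_le_norm ((s : ℂ) + y * Complex.I)
        simpa [hs] using this
    have e3 := e2 R (abs_of_pos hRp)
    have e4 := e2 (-R) (by rw [abs_neg, abs_of_pos hRp])
    have : (∫ t in (-R)..R, F t) = (∫ x in (-R)..R, F (x + R * Complex.I)) -
        Complex.I • (∫ y in (0 : ℝ)..R, F ((R : ℝ) + y * Complex.I)) +
        Complex.I • (∫ y in (0 : ℝ)..R, F ((-R : ℝ) + y * Complex.I)) := by
      linear_combination key
    rw [this]
    refine (norm_add_le _ _).trans ((add_le_add (norm_sub_le _ _) le_rfl).trans ?_)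
    rw [norm_smul, norm_smul, Complex.norm_I, one_mul, one_mul]
    refine (add_le_add (add_le_add e1 e3) e4).trans (le_of_eq ?_)
    rw [show R - -R = 2 * R by ring, sub_zero, abs_of_pos hRp,
      abs_of_pos (by linarith : (0 : ℝ) < 2 * R)]
    field_simp
    ring
  exact tendsto_nhds_unique h1 h2

/-- The Poisson formula for bounded holomorphic functions on a neighbourhood of the closed upper
half plane. -/
theorem integral_mul_halfPlanePoisson {g : ℂ → ℂ} {ε C : ℝ} (hε : 0 < ε)
    (hg : DifferentiableOn ℂ g {z | -ε < z.im}) (hC : ∀ z : ℂ, -ε < z.im → ‖g z‖ ≤ C)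
    (x : ℝ) {y : ℝ} (hy : 0 < y) :
    ∫ t : ℝ, (halfPlanePoisson y (x - t) : ℂ) * g t = g (x + y * Complex.I) := by
  set w : ℂ := x + y * Complex.I with hw
  have hwre : w.re = x := by simp [hw]
  have hwim : w.im = y := by simp [hw]
  have hopen : IsOpen {z : ℂ | -ε < z.im} := isOpen_lt continuous_const Complex.continuous_im
  have hwmem : {z : ℂ | -ε < z.im} ∈ 𝓝 w := hopen.mem_nhds (by
    simp only [Set.mem_ofPred_eq, hwim]; linarith)
  -- The removable singularity at `w` is filled in by `dslope`, and the pole at `conj w` lies in the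
  -- lower half plane. Boundedness of `g` gives the decay `|ζ|⁻²`, and on the real line `F` is the
  -- Poisson kernel times `g - g w`, up to the factor `π / y`.
  set F : ℂ → ℂ := fun ζ => dslope g w ζ * (ζ - conj w)⁻¹ with hFdef
  have hC0 : 0 ≤ C := (norm_nonneg _).trans (hC w (by rw [hwim]; linarith))
  have hFt : ∀ t : ℝ, F t = ((Real.pi / y : ℝ) : ℂ) *
      ((halfPlanePoisson y (x - t) : ℂ) * g t - (halfPlanePoisson y (x - t) : ℂ) * g w) := by
    intro t
    have hne : (t : ℂ) ≠ w := fun h => by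
      have := congrArg Complex.im h; rw [hwim] at this; simp at this; linarith
    have hne' : (t : ℂ) - conj w ≠ 0 := fun h => by
      have := congrArg Complex.im h; simp [hwim] at this; linarith
    have hcw : conj w = x - y * Complex.I := by simp [hw, sub_eq_add_neg]
    have hprod : ((t : ℂ) - w) * (t - conj w) = ((x : ℂ) - t) ^ 2 + (y : ℂ) ^ 2 := by
      rw [hcw, hw]
      linear_combination (-(y : ℂ) ^ 2) * Complex.I_sq
    have hpos : ((x : ℂ) - t) ^ 2 + (y : ℂ) ^ 2 ≠ 0 := by
      exact_mod_cast (by positivity : (x - t) ^ 2 + y ^ 2 ≠ 0)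
    have hyc : (y : ℂ) ≠ 0 := by exact_mod_cast hy.ne'
    have hpi : (Real.pi : ℂ) ≠ 0 := by exact_mod_cast Real.pi_ne_zero
    simp only [hFdef]
    rw [dslope_of_ne _ hne, slope_def_field, ← div_eq_mul_inv, div_div, hprod, halfPlanePoisson]
    push_cast
    field_simp
  have hgc : Continuous fun t : ℝ => g t := by
    refine continuous_iff_continuousAt.2 fun t => ?_
    have h := (hg.differentiableAt (hopen.mem_nhds (by simpa using hε : (t : ℂ) ∈ _))).continuousAt
    exact ContinuousAt.comp (f := fun t : ℝ => (t : ℂ)) h Complex.continuous_ofReal.continuousAt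
  have hi1 : Integrable fun t : ℝ => (halfPlanePoisson y (x - t) : ℂ) * g t := by
    refine (integrable_halfPlanePoisson_sub hy x).ofReal.mul_bdd hgc.aestronglyMeasurable
      (Eventually.of_forall fun t => hC _ (by simpa using hε))
  have hi2 : Integrable fun t : ℝ => (halfPlanePoisson y (x - t) : ℂ) * g w :=
    (integrable_halfPlanePoisson_sub hy x).ofReal.mul_const _
  have hFi : Integrable fun t : ℝ => F t := by
    simp_rw [hFt]
    exact (hi1.sub hi2).const_mul _
  have hnn : ∀ z : ℂ, 0 ≤ z.im → z - conj w ≠ 0 := fun z hz h => by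
    have := congrArg Complex.im h; simp [hwim] at this; linarith
  have hz0 : ∫ t : ℝ, F t = 0 := by
    refine integral_eq_zero_of_decay (M := 2 * C * 4) (R₀ := 2 * ‖w‖ + 1) (fun z hz => ?_)
      (fun z hz hzR => ?_) hFi
    · refine DifferentiableAt.mul ?_ (((differentiableAt_id).sub_const _).inv (hnn z hz))
      exact ((Complex.differentiableOn_dslope hwmem).2 hg).differentiableAt
        (hopen.mem_nhds (by simp only [Set.mem_ofPred_eq]; linarith))
    · have hzw : ‖z‖ / 2 ≤ ‖z - w‖ := by
        have := norm_sub_norm_le z w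
        linarith
      have hzw' : ‖z‖ / 2 ≤ ‖z - conj w‖ := by
        have := norm_sub_norm_le z (conj w)
        rw [Complex.norm_conj] at this
        linarith
      have hzp : 0 < ‖z‖ := by linarith [norm_nonneg w]
      have hne : z ≠ w := fun h => by
        rw [h, sub_self, norm_zero] at hzw
        rw [h] at hzp
        linarith
      simp only [hFdef]
      rw [dslope_of_ne _ hne, slope_def_field, ← div_eq_mul_inv, div_div, norm_div, norm_mul]
      have h1 : ‖g z - g w‖ ≤ 2 * C := by
        refine (norm_sub_le _ _).trans ?_
        linarith [hC z (by linarith), hC w (by rw [hwim]; linarith)]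
      calc _ ≤ 2 * C / (‖z‖ / 2 * (‖z‖ / 2)) := by gcongr
        _ = _ := by field_simp; ring
  simp_rw [hFt] at hz0
  rw [integral_const_mul, integral_sub hi1 hi2, integral_mul_const, integral_complex_ofReal,
    integral_halfPlanePoisson_sub hy, Complex.ofReal_one, one_mul] at hz0
  have hpy : ((Real.pi / y : ℝ) : ℂ) ≠ 0 := by
    exact_mod_cast (div_pos Real.pi_pos hy).ne'
  exact sub_eq_zero.1 ((mul_eq_zero.1 hz0).resolve_left hpy)

/-- The substitution `t = x - y s` rescales the kernel to height `1`. The resulting bound does not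
depend on `x` and tends to `0` with `y` by dominated convergence; the minimum with `1` is needed
because `|s|` is not integrable against the kernel. -/
theorem abs_integral_halfPlanePoisson_sub_le {f : ℝ → ℝ} {k : ℝ≥0} (hf : LipschitzWith k f)
    (hf0 : ∀ x, 0 ≤ f x) (hf1 : ∀ x, f x ≤ 1) {y : ℝ} (hy : 0 < y) (x : ℝ) :
    |(∫ t, halfPlanePoisson y (x - t) * f t) - f x| ≤
      ∫ s, halfPlanePoisson 1 s * min 1 (k * (y * |s|)) := by
  have h1 : (∫ t, halfPlanePoisson y (x - t) * f t) =
      ∫ s, halfPlanePoisson 1 s * f (x - y * s) := by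
    have e1 := integral_sub_left_eq_self (fun t => halfPlanePoisson y t * f (x - t)) volume x
    simp only [sub_sub_cancel] at e1
    have e2 := Measure.integral_comp_mul_left (fun t => halfPlanePoisson y t * f (x - t)) y
    simp_rw [halfPlanePoisson_mul hy, mul_assoc] at e2
    rw [integral_const_mul, abs_of_pos (inv_pos.2 hy), smul_eq_mul] at e2
    rw [e1]
    exact (mul_left_cancel₀ (inv_pos.2 hy).ne' e2).symm
  have hi : Integrable fun s => halfPlanePoisson 1 s * f (x - y * s) := by
    refine (integrable_halfPlanePoisson one_pos).mul_bdd (c := 1)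
      (hf.continuous.comp (by fun_prop)).aestronglyMeasurable (Eventually.of_forall fun s => ?_)
    rw [Real.norm_eq_abs, abs_of_nonneg (hf0 _)]
    exact hf1 _
  have h2 : f x = ∫ s, halfPlanePoisson 1 s * f x := by
    rw [integral_mul_const, integral_halfPlanePoisson one_pos, one_mul]
  rw [h1, h2]
  rw [← integral_sub hi ((integrable_halfPlanePoisson one_pos).mul_const _), ← Real.norm_eq_abs]
  refine norm_integral_le_of_norm_le ?_ (Eventually.of_forall fun s => ?_)
  · refine (integrable_halfPlanePoisson one_pos).mul_bdd (c := 1)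
      (Continuous.aestronglyMeasurable (by fun_prop)) (Eventually.of_forall fun s => ?_)
    rw [Real.norm_eq_abs, abs_of_nonneg (by positivity)]
    exact min_le_left _ _
  · rw [← mul_sub, norm_mul, Real.norm_eq_abs, abs_of_nonneg (halfPlanePoisson_nonneg zero_le_one s)]
    refine mul_le_mul_of_nonneg_left (le_min ?_ ?_) (halfPlanePoisson_nonneg zero_le_one s)
    · rw [Real.norm_eq_abs, abs_le]
      constructor <;> linarith [hf0 x, hf1 x, hf0 (x - y * s), hf1 (x - y * s)]
    · have := hf.dist_le_mul (x - y * s) x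
      rw [Real.dist_eq, Real.dist_eq] at this
      rw [Real.norm_eq_abs]
      refine this.trans (le_of_eq ?_)
      rw [sub_sub_cancel_left, abs_neg, abs_mul, abs_of_pos hy]

/-- Poisson extensions of a bounded Lipschitz function converge uniformly to the function. -/
theorem exists_abs_integral_halfPlanePoisson_sub_le {f : ℝ → ℝ} {k : ℝ≥0}
    (hf : LipschitzWith k f) (hf0 : ∀ x, 0 ≤ f x) (hf1 : ∀ x, f x ≤ 1) {η : ℝ} (hη : 0 < η) :
    ∃ y₀ > 0, ∀ y, 0 < y → y ≤ y₀ → ∀ x,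
      |(∫ t, halfPlanePoisson y (x - t) * f t) - f x| ≤ η := by
  have hlim : Tendsto (fun y : ℝ => ∫ s, halfPlanePoisson 1 s * min 1 (k * (y * |s|)))
      (𝓝[>] 0) (𝓝 (∫ _s : ℝ, (0 : ℝ))) := by
    refine tendsto_integral_filter_of_dominated_convergence (halfPlanePoisson 1)
      (Eventually.of_forall fun y => ?_) ?_ (integrable_halfPlanePoisson one_pos)
      (Eventually.of_forall fun s => ?_)
    · exact ((continuous_halfPlanePoisson one_pos).mul (by fun_prop)).aestronglyMeasurable
    · filter_upwards [self_mem_nhdsWithin] with y (hy : 0 < y)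
      refine Eventually.of_forall fun s => ?_
      rw [norm_mul, Real.norm_eq_abs, Real.norm_eq_abs,
        abs_of_nonneg (halfPlanePoisson_nonneg zero_le_one s), abs_of_nonneg (by positivity)]
      exact mul_le_of_le_one_right (halfPlanePoisson_nonneg zero_le_one s) (min_le_left _ _)
    · refine tendsto_nhdsWithin_of_tendsto_nhds ?_
      have : Continuous fun y : ℝ => halfPlanePoisson 1 s * min 1 (k * (y * |s|)) := by fun_prop
      simpa using this.tendsto 0
  rw [integral_zero] at hlim
  obtain ⟨u, hu, hsub⟩ := mem_nhdsGT_iff_exists_Ioc_subset.1 (hlim.eventually (gt_mem_nhds hη))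
  exact ⟨u, hu, fun y hy hyu x => (abs_integral_halfPlanePoisson_sub_le hf hf0 hf1 hy x).trans
    (le_of_lt (hsub ⟨hy, hyu⟩))⟩

/-! ### Boundary values of functions with a Herglotz-type bound -/

/-- Holomorphic functions on the upper half plane with non-negative imaginary part and the growth
bound `‖m z‖ ≤ C / Im z`. -/
structure IsHerglotz (m : ℂ → ℂ) (C : ℝ) : Prop where
  differentiableAt : ∀ z : ℂ, 0 < z.im → DifferentiableAt ℂ m z
  im_nonneg : ∀ z : ℂ, 0 < z.im → 0 ≤ (m z).im
  norm_le : ∀ z : ℂ, 0 < z.im → ‖m z‖ ≤ C / z.im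

namespace IsHerglotz

variable {m : ℂ → ℂ} {C : ℝ}

theorem im_pos_add (x : ℝ) {y : ℝ} (hy : 0 < y) : 0 < ((x : ℂ) + y * Complex.I).im := by
  simpa using hy

theorem continuous_im (hm : IsHerglotz m C) {y : ℝ} (hy : 0 < y) :
    Continuous fun t : ℝ => (m (t + y * Complex.I)).im := by
  refine Complex.continuous_im.comp (continuous_iff_continuousAt.2 fun t => ?_)
  exact ContinuousAt.comp (f := fun t : ℝ => (t : ℂ) + y * Complex.I)
    (hm.differentiableAt _ (im_pos_add t hy)).continuousAt
    (Continuous.continuousAt (by fun_prop))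

theorem im_le (hm : IsHerglotz m C) (x : ℝ) {y : ℝ} (hy : 0 < y) :
    (m (x + y * Complex.I)).im ≤ C / y := by
  have := (Complex.abs_im_le_norm _).trans (hm.norm_le _ (im_pos_add x hy))
  have h2 := (le_abs_self _).trans this
  simpa using h2

/-- Shifting `m` up by `ε` makes it bounded and holomorphic on `Im z > -ε / 2`, where the Poisson
formula applies; the claim is its imaginary part. -/
theorem im_add (hm : IsHerglotz m C) (x : ℝ) {y ε : ℝ} (hy : 0 < y) (hε : 0 < ε) :
    (m (x + (y + ε : ℝ) * Complex.I)).im =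
      ∫ t : ℝ, halfPlanePoisson y (x - t) * (m (t + ε * Complex.I)).im := by
  have hC0 : 0 ≤ C := by
    have := (norm_nonneg _).trans (hm.norm_le Complex.I (by simp))
    simpa using this
  have him : ∀ z : ℂ, -(ε / 2) < z.im → ε / 2 < (z + ε * Complex.I).im := by
    intro z hz
    simp only [Complex.add_im, Complex.mul_im, Complex.ofReal_re, Complex.I_im, Complex.ofReal_im,
      Complex.I_re]
    linarith
  have h := integral_mul_halfPlanePoisson (g := fun z => m (z + ε * Complex.I)) (ε := ε / 2)
    (C := C / (ε / 2)) (by positivity)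
    (fun z hz => by
      have h1 := hm.differentiableAt (z + ε * Complex.I) (by linarith [him z hz])
      exact (DifferentiableAt.comp (f := fun z : ℂ => z + ε * Complex.I) z h1
        (by fun_prop)).differentiableWithinAt)
    (fun z hz => (hm.norm_le _ (by linarith [him z hz])).trans
      (div_le_div_of_nonneg_left hC0 (by positivity) (him z hz).le)) x hy
  have hi : Integrable fun t : ℝ => (halfPlanePoisson y (x - t) : ℂ) * m (t + ε * Complex.I) := by
    refine (integrable_halfPlanePoisson_sub hy x).ofReal.mul_bdd (c := C / ε) ?_
      (Eventually.of_forall fun t => ?_)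
    · refine Continuous.aestronglyMeasurable (continuous_iff_continuousAt.2 fun t => ?_)
      exact ContinuousAt.comp (f := fun t : ℝ => (t : ℂ) + ε * Complex.I)
        (hm.differentiableAt _ (im_pos_add t hε)).continuousAt
        (Continuous.continuousAt (by fun_prop))
    · simpa using hm.norm_le _ (im_pos_add t hε)
  have h2 := integral_im hi
  simp only [RCLike.im_to_complex, Complex.im_ofReal_mul] at h2
  rw [h2, h]
  congr 2
  push_cast
  ring

/-- As `y → ∞`, `π y` times the Poisson kernel at height `y` tends to `1` pointwise, while `π y Im
m(i (y + ε)) ≤ π C`. Fatou's lemma yields a total mass bound that is uniform in `ε`. -/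
theorem lintegral_im_le (hm : IsHerglotz m C) {ε : ℝ} (hε : 0 < ε) :
    ∫⁻ t : ℝ, ENNReal.ofReal (m (t + ε * Complex.I)).im ≤ ENNReal.ofReal (Real.pi * C) := by
  have hC0 : 0 ≤ C := by
    have := (norm_nonneg _).trans (hm.norm_le Complex.I (by simp))
    simpa using this
  set V : ℝ → ℝ := fun t => (m (t + ε * Complex.I)).im with hV
  have hV0 : ∀ t, 0 ≤ V t := fun t => hm.im_nonneg _ (im_pos_add t hε)
  have hlim : ∀ t : ℝ, Tendsto (fun n : ℕ => ENNReal.ofReal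
      (Real.pi * (n + 1) * (halfPlanePoisson (n + 1) (0 - t) * V t))) atTop
      (𝓝 (ENNReal.ofReal (V t))) := by
    intro t
    refine ENNReal.tendsto_ofReal ?_
    have h1 : Tendsto (fun n : ℕ => (1 + ((n + 1 : ℝ)⁻¹ * t) ^ 2)⁻¹ * V t) atTop
        (𝓝 ((1 + (0 * t) ^ 2)⁻¹ * V t)) := by
      have h0 : Tendsto (fun n : ℕ => (n + 1 : ℝ)⁻¹) atTop (𝓝 0) := by
        simpa using tendsto_one_div_add_atTop_nhds_zero_nat (𝕜 := ℝ)
      refine Tendsto.mul_const _ (Tendsto.inv₀ (((h0.mul_const t).pow 2).const_add 1) (by positivity))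
    simp only [zero_mul, ne_eq, OfNat.ofNat_ne_zero, not_false_eq_true, zero_pow, add_zero, inv_one,
      one_mul] at h1
    refine h1.congr fun n => ?_
    have hn : (0 : ℝ) < n + 1 := by positivity
    rw [halfPlanePoisson_eq hn]
    field_simp
    ring
  have hmeas : ∀ n : ℕ, Measurable fun t : ℝ => ENNReal.ofReal
      (Real.pi * (n + 1) * (halfPlanePoisson (n + 1) (0 - t) * V t)) := by
    intro n
    refine Continuous.measurable (ENNReal.continuous_ofReal.comp ?_)
    exact continuous_const.mul (((continuous_halfPlanePoisson (by positivity)).comp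
      (by fun_prop)).mul (hm.continuous_im hε))
  calc ∫⁻ t : ℝ, ENNReal.ofReal (V t)
      = ∫⁻ t : ℝ, liminf (fun n : ℕ => ENNReal.ofReal
      (Real.pi * (n + 1) * (halfPlanePoisson (n + 1) (0 - t) * V t))) atTop :=
        lintegral_congr fun t => (hlim t).liminf_eq.symm
    _ ≤ liminf (fun n : ℕ => ∫⁻ t : ℝ, ENNReal.ofReal
      (Real.pi * (n + 1) * (halfPlanePoisson (n + 1) (0 - t) * V t))) atTop :=
        lintegral_liminf_le hmeas
    _ ≤ ENNReal.ofReal (Real.pi * C) := by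
        refine liminf_le_of_le (by isBoundedDefault) fun b hb => ?_
        obtain ⟨n, hn⟩ := hb.exists
        refine hn.trans ?_
        have hn1 : (0 : ℝ) < n + 1 := by positivity
        have hintgr : Integrable fun t => Real.pi * (n + 1) *
            (halfPlanePoisson (n + 1) (0 - t) * V t) := by
          refine Integrable.const_mul ((integrable_halfPlanePoisson_sub hn1 0).mul_bdd (c := C / ε)
            (hm.continuous_im hε).aestronglyMeasurable (Eventually.of_forall fun t => ?_)) _
          rw [Real.norm_eq_abs, abs_of_nonneg (hV0 t)]
          exact hm.im_le t hε
        rw [← ofReal_integral_eq_lintegral_ofReal hintgr (Eventually.of_forall fun t =>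
          mul_nonneg (by positivity) (mul_nonneg (halfPlanePoisson_nonneg hn1.le _) (hV0 t)))]
        refine ENNReal.ofReal_le_ofReal ?_
        rw [integral_const_mul, ← hm.im_add 0 hn1 hε, mul_assoc]
        refine mul_le_mul_of_nonneg_left ?_ Real.pi_pos.le
        have hle := hm.im_le 0 (add_pos hn1 hε)
        calc _ ≤ (n + 1 : ℝ) * (C / (n + 1 + ε)) := by gcongr
          _ ≤ C := by
            rw [mul_div_assoc', div_le_iff₀ (by positivity)]
            nlinarith

theorem integrable_im (hm : IsHerglotz m C) {ε : ℝ} (hε : 0 < ε) :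
    Integrable fun t : ℝ => (m (t + ε * Complex.I)).im := by
  refine ⟨(hm.continuous_im hε).aestronglyMeasurable, ?_⟩
  rw [hasFiniteIntegral_iff_ofReal (Eventually.of_forall fun t => hm.im_nonneg _ (im_pos_add t hε))]
  exact (hm.lintegral_im_le hε).trans_lt ENNReal.ofReal_lt_top

theorem integral_im_le (hm : IsHerglotz m C) (hC : 0 ≤ C) {ε : ℝ} (hε : 0 < ε) :
    ∫ t : ℝ, (m (t + ε * Complex.I)).im ≤ Real.pi * C := by
  rw [integral_eq_lintegral_of_nonneg_ae
    (Eventually.of_forall fun t => hm.im_nonneg _ (im_pos_add t hε))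
    (hm.continuous_im hε).aestronglyMeasurable]
  exact ENNReal.toReal_le_of_le_ofReal (by positivity) (hm.lintegral_im_le hε)

end IsHerglotz

/-- Moving the Poisson extension from a finite measure to the test function. -/
theorem integral_mul_integral_halfPlanePoisson {f V : ℝ → ℝ} {y : ℝ} (hy : 0 < y)
    {ν : Measure ℝ} [SFinite ν] (hf : Integrable f) (hV : Integrable V ν) :
    ∫ x, f x * ∫ t, halfPlanePoisson y (x - t) * V t ∂ν =
      ∫ t, (∫ x, halfPlanePoisson y (t - x) * f x) * V t ∂ν := by
  have hintgr : Integrable (Function.uncurry fun x t => f x * (halfPlanePoisson y (x - t) * V t))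
      (volume.prod ν) := by
    have h1 : Integrable (fun p : ℝ × ℝ => f p.1 * V p.2) (volume.prod ν) := hf.mul_prod hV
    have h2 := h1.bdd_mul (c := y⁻¹) (f := fun p : ℝ × ℝ => halfPlanePoisson y (p.1 - p.2))
      (((continuous_halfPlanePoisson hy).comp (by fun_prop)).aestronglyMeasurable)
      (Eventually.of_forall fun p => by
        rw [Real.norm_eq_abs, abs_of_nonneg (halfPlanePoisson_nonneg hy.le _)]
        exact halfPlanePoisson_le hy _)
    refine h2.congr (Eventually.of_forall fun p => ?_)
    simp only [Function.uncurry]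
    ring
  simp_rw [← integral_const_mul]
  rw [integral_integral_swap hintgr]
  refine integral_congr_ae (Eventually.of_forall fun t => ?_)
  simp only
  rw [← integral_mul_const]
  refine integral_congr_ae (Eventually.of_forall fun x => ?_)
  simp only
  rw [← halfPlanePoisson_neg y (x - t), neg_sub]
  ring

/-- The values at height `y₀` are the Poisson extension, by `y₀ - ε`, of those at height `ε`. Moving
the kernel onto `f` changes `f` by at most `η`, and the mass at height `ε` is at most `π C`. -/
theorem IsHerglotz.integral_mul_im_le {m : ℂ → ℂ} {C : ℝ} (hm : IsHerglotz m C) (hC : 0 ≤ C)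
    {f : ℝ → ℝ} {k : ℝ≥0} (hf : LipschitzWith k f) (hf0 : ∀ x, 0 ≤ f x) (hf1 : ∀ x, f x ≤ 1)
    (hfi : Integrable f) {η y₀ ε : ℝ} (happ : ∀ y, 0 < y → y ≤ y₀ → ∀ x,
      |(∫ t, halfPlanePoisson y (x - t) * f t) - f x| ≤ η) (hε : 0 < ε) (hεy : ε < y₀) :
    ∫ t : ℝ, f t * (m (t + ε * Complex.I)).im ≤
      (∫ t : ℝ, f t * (m (t + y₀ * Complex.I)).im) + Real.pi * C * η := by
  have hy : 0 < y₀ - ε := by linarith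
  have hη : 0 ≤ η := (abs_nonneg _).trans (happ _ hy (by linarith) 0)
  have hVi := hm.integrable_im hε
  have hfV : Integrable fun t : ℝ => f t * (m (t + ε * Complex.I)).im :=
    hVi.bdd_mul (c := 1) hf.continuous.aestronglyMeasurable (Eventually.of_forall fun t => by
      rw [Real.norm_eq_abs, abs_of_nonneg (hf0 t)]; exact hf1 t)
  have hsplit : ∀ x : ℝ, (m (x + y₀ * Complex.I)).im =
      ∫ t : ℝ, halfPlanePoisson (y₀ - ε) (x - t) * (m (t + ε * Complex.I)).im := by
    intro x
    rw [← hm.im_add x hy hε, sub_add_cancel]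
  simp_rw [hsplit]
  rw [integral_mul_integral_halfPlanePoisson hy hfi hVi]
  have hlow : Integrable fun t : ℝ => f t * (m (t + ε * Complex.I)).im -
      η * (m (t + ε * Complex.I)).im := hfV.sub (hVi.const_mul η)
  have hPV : Integrable fun t : ℝ => (∫ x, halfPlanePoisson (y₀ - ε) (t - x) * f x) *
      (m (t + ε * Complex.I)).im := by
    refine hVi.bdd_mul (c := 1 + η) ?_ (Eventually.of_forall fun t => ?_)
    · have h1 : Measurable (Function.uncurry fun t x => halfPlanePoisson (y₀ - ε) (t - x) * f x) :=
        (((continuous_halfPlanePoisson hy).comp (by fun_prop)).mul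
          (hf.continuous.comp continuous_snd)).measurable
      exact (h1.stronglyMeasurable.integral_prod_right).aestronglyMeasurable
    · have h := abs_le.1 (happ _ hy (by linarith) t)
      rw [Real.norm_eq_abs, abs_le]
      constructor <;> linarith [h.1, h.2, hf0 t, hf1 t]
  have hle := integral_mono hlow hPV fun t => by
    have h := abs_le.1 (happ _ hy (by linarith) t)
    have h0 := hm.im_nonneg _ (IsHerglotz.im_pos_add t hε)
    simp only
    rw [← sub_mul]
    exact mul_le_mul_of_nonneg_right (by linarith [h.1]) h0
  rw [integral_sub hfV (hVi.const_mul η), integral_const_mul] at hle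
  have := mul_le_mul_of_nonneg_left (hm.integral_im_le hC hε) hη
  linarith

/-- Fatou's lemma lets the lower height tend to `0`. Only an upper bound survives, since the
boundary measure may have a singular part, but an upper bound is what is needed. -/
theorem IsHerglotz.lintegral_boundary_le {m : ℂ → ℂ} {C : ℝ} (hm : IsHerglotz m C) (hC : 0 ≤ C)
    {f : ℝ → ℝ} {k : ℝ≥0} (hf : LipschitzWith k f) (hf0 : ∀ x, 0 ≤ f x) (hf1 : ∀ x, f x ≤ 1)
    (hfi : Integrable f) {η y₀ : ℝ} (hy₀ : 0 < y₀) (happ : ∀ y, 0 < y → y ≤ y₀ → ∀ x,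
      |(∫ t, halfPlanePoisson y (x - t) * f t) - f x| ≤ η) {ρ : ℝ → ℝ}
    (hρ : ∀ᵐ t : ℝ, Tendsto (fun ε : ℝ => (m (t + ε * Complex.I)).im) (𝓝[>] 0) (𝓝 (ρ t))) :
    ∫⁻ t, ENNReal.ofReal (f t * ρ t) ≤
      ENNReal.ofReal ((∫ t : ℝ, f t * (m (t + y₀ * Complex.I)).im) + Real.pi * C * η) := by
  -- The shift by `2` makes `e n < y₀` strict already for `n = 0`.
  set e : ℕ → ℝ := fun n => y₀ / (n + 2) with he
  have he0 : ∀ n, 0 < e n := fun n => by simp only [he]; positivity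
  have hey : ∀ n, e n < y₀ := fun n => by
    simp only [he]
    rw [div_lt_iff₀ (by positivity)]
    have : (0 : ℝ) ≤ n := by positivity
    nlinarith
  have hlim : Tendsto e atTop (𝓝[>] 0) := by
    refine tendsto_nhdsWithin_iff.2 ⟨?_, Eventually.of_forall he0⟩
    exact tendsto_const_nhds.div_atTop (tendsto_atTop_add_const_right _ _ tendsto_natCast_atTop_atTop)
  have hcont : ∀ n, Continuous fun t : ℝ => f t * (m (t + e n * Complex.I)).im := fun n =>
    hf.continuous.mul (hm.continuous_im (he0 n))
  calc ∫⁻ t, ENNReal.ofReal (f t * ρ t)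
      = ∫⁻ t, liminf (fun n => ENNReal.ofReal (f t * (m (t + e n * Complex.I)).im)) atTop := by
        refine lintegral_congr_ae (hρ.mono fun t ht => ?_)
        exact (ENNReal.tendsto_ofReal ((ht.comp hlim).const_mul (f t))).liminf_eq.symm
    _ ≤ liminf (fun n => ∫⁻ t, ENNReal.ofReal (f t * (m (t + e n * Complex.I)).im)) atTop :=
        lintegral_liminf_le fun n => (ENNReal.continuous_ofReal.comp (hcont n)).measurable
    _ ≤ _ := by
        refine liminf_le_of_le (by isBoundedDefault) fun b hb => ?_
        obtain ⟨n, hn⟩ := hb.exists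
        refine hn.trans ?_
        have hfV : Integrable fun t : ℝ => f t * (m (t + e n * Complex.I)).im :=
          (hm.integrable_im (he0 n)).bdd_mul (c := 1) hf.continuous.aestronglyMeasurable
            (Eventually.of_forall fun t => by
              rw [Real.norm_eq_abs, abs_of_nonneg (hf0 t)]; exact hf1 t)
        rw [← ofReal_integral_eq_lintegral_ofReal hfV (Eventually.of_forall fun t =>
          mul_nonneg (hf0 t) (hm.im_nonneg _ (IsHerglotz.im_pos_add t (he0 n))))]
        exact ENNReal.ofReal_le_ofReal
          (hm.integral_mul_im_le hC hf hf0 hf1 hfi happ (he0 n) (hey n))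

/-! ### Stieltjes transforms of finite measures -/

/-- The Stieltjes (Borel) transform of a measure on the real line. -/
def stieltjesTransform (ν : Measure ℝ) (z : ℂ) : ℂ := ∫ x : ℝ, ((x : ℂ) - z)⁻¹ ∂ν

theorem integrable_inv_sub (ν : Measure ℝ) [IsFiniteMeasure ν] {z : ℂ} (hz : z.im ≠ 0) :
    Integrable (fun x : ℝ => ((x : ℂ) - z)⁻¹) ν := by
  have hne : ∀ x : ℝ, (x : ℂ) - z ≠ 0 := fun x h => hz (by simpa using congrArg Complex.im h)
  refine Integrable.of_bound (C := |z.im|⁻¹) (Continuous.aestronglyMeasurable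
    (Continuous.inv₀ (by fun_prop) hne)) (Eventually.of_forall fun x => ?_)
  rw [norm_inv]
  refine inv_anti₀ (abs_pos.2 hz) ?_
  simpa using Complex.abs_im_le_norm ((x : ℂ) - z)

theorem im_stieltjesTransform (ν : Measure ℝ) [IsFiniteMeasure ν] (t : ℝ) {y : ℝ} (hy : 0 < y) :
    (stieltjesTransform ν (t + y * Complex.I)).im =
      Real.pi * ∫ x, halfPlanePoisson y (t - x) ∂ν := by
  have h := integral_im (integrable_inv_sub ν (z := t + y * Complex.I) (by simpa using hy.ne'))
  simp only [RCLike.im_to_complex, im_inv_sub_eq_halfPlanePoisson] at h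
  rw [stieltjesTransform, ← h, integral_const_mul]

/-- Quantitative Stieltjes inversion: by Fubini the Poisson kernel moves from `ν` onto the test
function, where it costs at most `η` pointwise. -/
theorem abs_integral_mul_im_stieltjesTransform_sub_le (ν : Measure ℝ) [IsFiniteMeasure ν]
    {f : ℝ → ℝ} {k : ℝ≥0} (hf : LipschitzWith k f) (hf0 : ∀ x, 0 ≤ f x) (hf1 : ∀ x, f x ≤ 1)
    (hfi : Integrable f) {η y : ℝ} (hy : 0 < y) (happ : ∀ x,
      |(∫ t, halfPlanePoisson y (x - t) * f t) - f x| ≤ η) :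
    |(∫ t : ℝ, f t * (stieltjesTransform ν (t + y * Complex.I)).im) - Real.pi * ∫ x, f x ∂ν| ≤
      Real.pi * (η * ν.real Set.univ) := by
  simp_rw [im_stieltjesTransform ν _ hy]
  have h1 := integral_mul_integral_halfPlanePoisson (V := fun _ => 1) hy hfi (integrable_const _)
    (ν := ν)
  simp only [mul_one] at h1
  simp_rw [mul_left_comm (f _) Real.pi]
  rw [integral_const_mul, h1, ← mul_sub, abs_mul, abs_of_pos Real.pi_pos]
  refine mul_le_mul_of_nonneg_left ?_ Real.pi_pos.le
  have hfν : Integrable f ν := Integrable.of_bound (C := 1) hf.continuous.aestronglyMeasurable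
    (Eventually.of_forall fun t => by rw [Real.norm_eq_abs, abs_of_nonneg (hf0 t)]; exact hf1 t)
  have hPν : Integrable (fun t => ∫ x, halfPlanePoisson y (t - x) * f x) ν := by
    refine Integrable.of_bound (C := 1 + η) ?_ (Eventually.of_forall fun t => ?_)
    · have h1 : Measurable (Function.uncurry fun t x => halfPlanePoisson y (t - x) * f x) :=
        (((continuous_halfPlanePoisson hy).comp (by fun_prop)).mul
          (hf.continuous.comp continuous_snd)).measurable
      exact (h1.stronglyMeasurable.integral_prod_right).aestronglyMeasurable
    · have h := abs_le.1 (happ t)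
      rw [Real.norm_eq_abs, abs_le]
      constructor <;> linarith [h.1, h.2, hf0 t, hf1 t]
  rw [← integral_sub hPν hfν, ← Real.norm_eq_abs]
  exact norm_integral_le_of_norm_le_const (Eventually.of_forall happ)

theorem integrable_thickenedIndicator_of_isCompact {K : Set ℝ} (hK : IsCompact K) {d : ℝ}
    (hd : 0 < d) : Integrable fun x : ℝ => (thickenedIndicator hd K x : ℝ) := by
  have hc : Continuous fun x : ℝ => (thickenedIndicator hd K x : ℝ) := by fun_prop
  refine hc.integrable_of_hasCompactSupport (HasCompactSupport.intro (hK.cthickening (r := d))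
    fun x hx => ?_)
  have : x ∉ Metric.thickening d K := fun h => hx (Metric.thickening_subset_cthickening d K h)
  simp [thickenedIndicator_zero hd K this]

theorem lipschitzWith_coe_thickenedIndicator (K : Set ℝ) {d : ℝ} (hd : 0 < d) :
    LipschitzWith d.toNNReal⁻¹ fun x : ℝ => (thickenedIndicator hd K x : ℝ) := by
  have := lipschitzWith_thickenedIndicator hd K
  exact this

/-- If the imaginary parts of Herglotz functions converge to those of the Stieltjes transform of
`ν`, their boundary values vanish in the limit on compact `ν`-null sets. -/
theorem tendsto_lintegral_boundary_zero {m : ℕ → ℂ → ℂ} {C : ℝ} (hC : 0 ≤ C)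
    (hm : ∀ n, IsHerglotz (m n) C) (ν : Measure ℝ) [IsFiniteMeasure ν]
    (hlim : ∀ z : ℂ, 0 < z.im → Tendsto (fun n => m n z) atTop (𝓝 (stieltjesTransform ν z)))
    {ρ : ℕ → ℝ → ℝ} (hρ : ∀ n, ∀ᵐ t : ℝ,
      Tendsto (fun ε : ℝ => (m n (t + ε * Complex.I)).im) (𝓝[>] 0) (𝓝 (ρ n t)))
    {K : Set ℝ} (hK : IsCompact K) (hνK : ν K = 0) :
    Tendsto (fun n => ∫⁻ t in K, ENNReal.ofReal (ρ n t)) atTop (𝓝 0) := by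
  refine ENNReal.tendsto_nhds_zero.2 fun e he => ?_
  obtain ⟨e', he', he0, hee⟩ := ENNReal.lt_iff_exists_real_btwn.1 he
  replace he0 : 0 < e' := ENNReal.ofReal_pos.1 he0
  -- The four summands collect the errors, in units of `η`: the mass `∫ f dν`, the Poisson
  -- approximation against `ν`, the convergence in `n` at height `y₀`, and the passage from height
  -- `y₀` to the boundary.
  set A : ℝ := Real.pi + Real.pi * ν.real Set.univ + 1 + Real.pi * C with hA
  have hApos : 0 < A := by
    have := Real.pi_pos
    have := measureReal_nonneg (μ := ν) (s := Set.univ)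
    positivity
  set η := e' / A with hη
  have hηpos : 0 < η := div_pos he0 hApos
  have hd : ∀ n : ℕ, (0 : ℝ) < 1 / (n + 1) := fun n => by positivity
  have hthick := tendsto_integral_thickenedIndicator_of_isClosed ν hK.isClosed hd
    tendsto_one_div_add_atTop_nhds_zero_nat
  rw [Measure.real, hνK, ENNReal.toReal_zero] at hthick
  obtain ⟨N, hN⟩ := (hthick.eventually (gt_mem_nhds hηpos)).exists
  set f : ℝ → ℝ := fun x => (thickenedIndicator (hd N) K x : ℝ) with hf
  have hfL := lipschitzWith_coe_thickenedIndicator K (hd N)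
  have hf0 : ∀ x, 0 ≤ f x := fun x => NNReal.coe_nonneg _
  have hf1 : ∀ x, f x ≤ 1 := fun x => by
    exact NNReal.coe_le_one.2 (thickenedIndicator_le_one (hd N) K x)
  have hfi := integrable_thickenedIndicator_of_isCompact hK (hd N)
  obtain ⟨y₀, hy₀, happ⟩ := exists_abs_integral_halfPlanePoisson_sub_le hfL hf0 hf1 hηpos
  have hconv : Tendsto (fun n => ∫ t : ℝ, f t * (m n (t + y₀ * Complex.I)).im) atTop
      (𝓝 (∫ t : ℝ, f t * (stieltjesTransform ν (t + y₀ * Complex.I)).im)) := by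
    refine tendsto_integral_of_dominated_convergence (fun t => f t * (C / y₀))
      (fun n => (hfL.continuous.mul ((hm n).continuous_im hy₀)).aestronglyMeasurable)
      (hfi.mul_const _) (fun n => Eventually.of_forall fun t => ?_)
      (Eventually.of_forall fun t => ?_)
    · rw [norm_mul, Real.norm_eq_abs, Real.norm_eq_abs, abs_of_nonneg (hf0 t),
        abs_of_nonneg ((hm n).im_nonneg _ (IsHerglotz.im_pos_add t hy₀))]
      exact mul_le_mul_of_nonneg_left ((hm n).im_le t hy₀) (hf0 t)
    · exact ((Complex.continuous_im.tendsto _).comp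
        (hlim _ (IsHerglotz.im_pos_add t hy₀))).const_mul _
  have hst := abs_le.1 (abs_integral_mul_im_stieltjesTransform_sub_le ν hfL hf0 hf1 hfi hy₀
    (happ y₀ hy₀ le_rfl))
  filter_upwards [hconv.eventually (gt_mem_nhds (lt_add_of_pos_right _ hηpos))] with n hn
  have hb := (hm n).lintegral_boundary_le hC hfL hf0 hf1 hfi hy₀ happ (hρ n)
  refine le_trans ?_ (hb.trans (le_trans (ENNReal.ofReal_le_ofReal ?_) hee.le))
  · rw [← lintegral_indicator hK.isClosed.measurableSet]
    refine lintegral_mono fun t => ?_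
    by_cases ht : t ∈ K
    · rw [Set.indicator_of_mem ht, thickenedIndicator_one (hd N) K ht]
      simp
    · rw [Set.indicator_of_notMem ht]
      exact zero_le
  · have hNN : Real.pi * ∫ x, f x ∂ν ≤ Real.pi * η :=
      mul_le_mul_of_nonneg_left hN.le Real.pi_pos.le
    have hAe : A * η = e' := by rw [hη]; field_simp
    rw [← hAe, hA]
    have h2 := hst.2
    have h3 : ∫ t : ℝ, f t * (m n (t + y₀ * Complex.I)).im <
      (∫ t : ℝ, f t * (stieltjesTransform ν (t + y₀ * Complex.I)).im) + η := hn
    have h4 : (∫ t : ℝ, f t * (stieltjesTransform ν (t + y₀ * Complex.I)).im) ≤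
      Real.pi * (∫ x, f x ∂ν) + Real.pi * (η * ν.real Set.univ) := by linarith
    calc _ ≤ Real.pi * η + Real.pi * (η * ν.real Set.univ) + η + Real.pi * C * η := by
          linarith
      _ = _ := by ring

/-- A finite measure on the real line is determined by its Stieltjes transform. -/
theorem measure_eq_of_stieltjesTransform_eq {μ ν : Measure ℝ} [IsFiniteMeasure μ]
    [IsFiniteMeasure ν]
    (h : ∀ z : ℂ, 0 < z.im → stieltjesTransform μ z = stieltjesTransform ν z) : μ = ν := by
  have hd : ∀ n : ℕ, (0 : ℝ) < 1 / (n + 1) := fun n => by positivity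
  refine Measure.ext_of_Icc _ _ fun a b _ => ?_
  set K := Set.Icc a b
  have hK : IsCompact K := isCompact_Icc
  have h1 := tendsto_integral_thickenedIndicator_of_isClosed μ hK.isClosed hd
    tendsto_one_div_add_atTop_nhds_zero_nat
  have h2 := tendsto_integral_thickenedIndicator_of_isClosed ν hK.isClosed hd
    tendsto_one_div_add_atTop_nhds_zero_nat
  have heq : ∀ n, ∫ x, (thickenedIndicator (hd n) K x : ℝ) ∂μ =
      ∫ x, (thickenedIndicator (hd n) K x : ℝ) ∂ν := by
    intro n
    have hfL := lipschitzWith_coe_thickenedIndicator K (hd n)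
    have hfi := integrable_thickenedIndicator_of_isCompact hK (hd n)
    set f : ℝ → ℝ := fun x => (thickenedIndicator (hd n) K x : ℝ) with hf
    have hf0 : ∀ x, 0 ≤ f x := fun x => NNReal.coe_nonneg _
    have hf1 : ∀ x, f x ≤ 1 := fun x => by
      exact NNReal.coe_le_one.2 (thickenedIndicator_le_one (hd n) K x)
    refine eq_of_abs_sub_le_all fun e he => ?_
    set A : ℝ := μ.real Set.univ + ν.real Set.univ + 1 with hA
    have hApos : 0 < A := by
      have := measureReal_nonneg (μ := ν) (s := Set.univ)
      have := measureReal_nonneg (μ := μ) (s := Set.univ)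
      positivity
    obtain ⟨y₀, hy₀, happ⟩ := exists_abs_integral_halfPlanePoisson_sub_le hfL hf0 hf1
      (div_pos he hApos)
    have e1 := abs_le.1 (abs_integral_mul_im_stieltjesTransform_sub_le μ hfL hf0 hf1 hfi hy₀
      (happ y₀ hy₀ le_rfl))
    have e2 := abs_le.1 (abs_integral_mul_im_stieltjesTransform_sub_le ν hfL hf0 hf1 hfi hy₀
      (happ y₀ hy₀ le_rfl))
    simp_rw [fun t : ℝ => h (t + y₀ * Complex.I) (IsHerglotz.im_pos_add t hy₀)] at e1
    have hle : Real.pi * |(∫ x, f x ∂μ) - ∫ x, f x ∂ν| ≤ Real.pi * e := by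
      rw [← abs_of_pos Real.pi_pos, ← abs_mul, abs_of_pos Real.pi_pos, mul_sub]
      have : Real.pi * (e / A * μ.real Set.univ) + Real.pi * (e / A * ν.real Set.univ) ≤
          Real.pi * e := by
        rw [← mul_add, ← mul_add]
        refine mul_le_mul_of_nonneg_left ?_ Real.pi_pos.le
        rw [div_mul_eq_mul_div, div_le_iff₀ hApos]
        exact mul_le_mul_of_nonneg_left (by linarith) he.le
      rw [abs_le]
      constructor <;> linarith [e1.1, e1.2, e2.1, e2.2]
    exact le_of_mul_le_mul_left hle Real.pi_pos
  simp_rw [heq] at h1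
  have := tendsto_nhds_unique h1 h2
  exact (measureReal_eq_measureReal_iff).1 this

/-! ### Resolvents of self-adjoint operators -/

section Resolvent

variable {E : Type*} [NormedAddCommGroup E] [InnerProductSpace ℂ E]

/-- `R` is the resolvent `(A - z)⁻¹`, as an everywhere defined right inverse of `A - z`. -/
def IsResolvent (A : E →ₗ.[ℂ] E) (z : ℂ) (R : E →L[ℂ] E) : Prop :=
  ∀ η, ∃ ψ : A.domain, (ψ : E) = R η ∧ A ψ - z • (ψ : E) = η

variable [CompleteSpace E] {A : E →ₗ.[ℂ] E}

theorem IsSelfAdjoint.inner_apply (hA : IsSelfAdjoint A) (x y : A.domain) :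
    inner ℂ (A x) (y : E) = inner ℂ (x : E) (A y) := by
  have h := LinearPMap.adjoint_isFormalAdjoint hA.dense_domain
  rw [LinearPMap.isSelfAdjoint_def.1 hA] at h
  exact h x y

theorem IsSelfAdjoint.im_inner_sub_smul (hA : IsSelfAdjoint A) (z : ℂ) (x : A.domain) :
    (inner ℂ (x : E) (A x - z • (x : E))).im = -(z.im * ‖(x : E)‖ ^ 2) := by
  have h1 : (inner ℂ (x : E) (A x)).im = 0 := by
    rw [← Complex.conj_eq_iff_im, inner_conj_symm, hA.inner_apply]
  rw [inner_sub_right, inner_smul_right, inner_self_eq_norm_sq_to_K, Complex.sub_im, h1]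
  have : ((‖(x : E)‖ : ℂ) ^ 2) = ((‖(x : E)‖ ^ 2 : ℝ) : ℂ) := by push_cast; rfl
  simp only [Complex.coe_algebraMap]
  rw [this, Complex.mul_im, Complex.ofReal_im, Complex.ofReal_re]
  ring

theorem IsSelfAdjoint.abs_im_mul_norm_le (hA : IsSelfAdjoint A) (z : ℂ) (x : A.domain) :
    |z.im| * ‖(x : E)‖ ≤ ‖A x - z • (x : E)‖ := by
  rcases (norm_nonneg (x : E)).eq_or_lt with h0 | h0
  · rw [← h0, mul_zero]; exact norm_nonneg _
  have h1 := hA.im_inner_sub_smul z x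
  have h2 := (Complex.abs_im_le_norm _).trans (norm_inner_le_norm (𝕜 := ℂ) (x : E) (A x - z • (x : E)))
  rw [h1, abs_neg, abs_mul, abs_of_nonneg (sq_nonneg ‖(x : E)‖)] at h2
  nlinarith

theorem IsSelfAdjoint.eq_of_sub_smul_eq (hA : IsSelfAdjoint A) {z : ℂ} (hz : z.im ≠ 0)
    {x y : A.domain} (h : A x - z • (x : E) = A y - z • (y : E)) : x = y := by
  have h1 := hA.abs_im_mul_norm_le z (x - y)
  have h2 : A (x - y) - z • ((x - y : A.domain) : E) = 0 := by
    rw [LinearPMap.map_sub, Submodule.coe_sub, smul_sub, ← sub_eq_zero.2 h]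
    abel
  rw [h2, norm_zero] at h1
  have h3 : ‖((x - y : A.domain) : E)‖ = 0 := by
    have := abs_pos.2 hz
    nlinarith [norm_nonneg ((x - y : A.domain) : E)]
  have h4 := norm_eq_zero.1 h3
  rw [Submodule.coe_sub, sub_eq_zero] at h4
  exact Subtype.ext h4

/-- The range of `A - z` is the image of the complete graph of `A` under a map bounded below, hence
closed. A vector orthogonal to it lies in the domain of the adjoint, which is `A`, and is an
eigenvector for `conj z` unless it vanishes; the same lower bound excludes non-real eigenvalues. -/
theorem IsSelfAdjoint.exists_sub_smul_eq (hA : IsSelfAdjoint A) {z : ℂ} (hz : z.im ≠ 0) (η : E) :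
    ∃ ψ : A.domain, A ψ - z • (ψ : E) = η := by
  let T : A.domain →ₗ[ℂ] E := A.toFun - z • A.domain.subtype
  have hT : ∀ ψ, T ψ = A ψ - z • (ψ : E) := fun ψ => rfl
  suffices h : LinearMap.range T = ⊤ by
    obtain ⟨ψ, hψ⟩ := LinearMap.range_eq_top.1 h η
    exact ⟨ψ, hψ⟩
  have hclosed : IsClosed (LinearMap.range T : Set E) := by
    have hg : IsClosed (A.graph : Set (E × E)) := hA.isClosed
    have : CompleteSpace A.graph := hg.completeSpace_coe
    let S : A.graph →ₗ[ℂ] E :=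
      (LinearMap.snd ℂ E E - z • LinearMap.fst ℂ E E) ∘ₗ A.graph.subtype
    have hSc : Continuous S := by
      change Continuous fun p : A.graph => (p : E × E).2 - z • (p : E × E).1
      fun_prop
    have hzp := abs_pos.2 hz
    have hb : ∀ p : A.graph, ‖p‖ ≤ ((1 + (1 + ‖z‖) * |z.im|⁻¹).toNNReal : ℝ) * ‖S p‖ := by
      rintro ⟨⟨x, y⟩, hp⟩
      obtain ⟨u, hu1, hu2⟩ := (LinearPMap.mem_graph_iff A).1 hp
      simp only at hu1 hu2
      subst hu1
      subst hu2
      have hS : S ⟨((u : E), A u), hp⟩ = A u - z • (u : E) := rfl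
      rw [hS, Real.coe_toNNReal _ (by positivity)]
      have h1 := hA.abs_im_mul_norm_le z u
      have h2 : ‖(u : E)‖ ≤ |z.im|⁻¹ * ‖A u - z • (u : E)‖ := by
        rw [inv_mul_eq_div, le_div_iff₀ hzp]
        linarith
      have h3 : ‖A u‖ ≤ ‖A u - z • (u : E)‖ + ‖z‖ * ‖(u : E)‖ := by
        have := norm_add_le (A u - z • (u : E)) (z • (u : E))
        rwa [sub_add_cancel, norm_smul] at this
      have h4 : ‖z‖ * ‖(u : E)‖ ≤ ‖z‖ * (|z.im|⁻¹ * ‖A u - z • (u : E)‖) := by gcongr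
      have h5 : 0 ≤ ‖A u - z • (u : E)‖ := norm_nonneg _
      have h6 : 0 ≤ |z.im|⁻¹ * ‖A u - z • (u : E)‖ := by positivity
      have h7 : 0 ≤ ‖z‖ * (|z.im|⁻¹ * ‖A u - z • (u : E)‖) := by positivity
      have : ‖(⟨((u : E), A u), hp⟩ : A.graph)‖ = max ‖(u : E)‖ ‖A u‖ := rfl
      rw [this]
      refine max_le ?_ ?_ <;> nlinarith
    have hanti : AntilipschitzWith (1 + (1 + ‖z‖) * |z.im|⁻¹).toNNReal S :=
      AddMonoidHomClass.antilipschitz_of_bound S hb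
    have hcl := hanti.isClosed_range (uniformContinuous_addMonoidHom_of_continuous hSc)
    convert hcl using 1
    ext y
    constructor
    · rintro ⟨ψ, rfl⟩
      exact ⟨⟨((ψ : E), A ψ), A.mem_graph ψ⟩, rfl⟩
    · rintro ⟨⟨⟨x, y'⟩, hp⟩, rfl⟩
      obtain ⟨u, hu1, hu2⟩ := (LinearPMap.mem_graph_iff A).1 hp
      simp only at hu1 hu2
      subst hu1
      subst hu2
      exact ⟨u, rfl⟩
  have : CompleteSpace (LinearMap.range T) := hclosed.completeSpace_coe
  rw [← Submodule.orthogonal_eq_bot_iff]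
  refine (Submodule.eq_bot_iff _).2 fun y hy => ?_
  have hy' : ∀ x : A.domain, inner ℂ (A x - z • (x : E)) y = 0 := fun x =>
    (Submodule.mem_orthogonal _ _).1 hy _ ⟨x, rfl⟩
  have hxy : ∀ x : A.domain, inner ℂ (conj z • y) (x : E) = inner ℂ y (A x) := by
    intro x
    have h := hy' x
    rw [inner_sub_left, sub_eq_zero, inner_smul_left] at h
    rw [inner_smul_left, Complex.conj_conj, ← inner_conj_symm, ← inner_conj_symm y, h, map_mul,
      Complex.conj_conj]
  have hymem' : y ∈ A.adjoint.domain := LinearPMap.mem_adjoint_domain_of_exists y ⟨_, hxy⟩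
  have hAy' := LinearPMap.adjoint_apply_eq hA.dense_domain ⟨y, hymem'⟩ hxy
  have hgr : (y, conj z • y) ∈ A.adjoint.graph := by
    rw [← hAy']; exact LinearPMap.mem_graph _ ⟨y, hymem'⟩
  rw [LinearPMap.isSelfAdjoint_def.1 hA] at hgr
  obtain ⟨u, hu1, hu2⟩ := (LinearPMap.mem_graph_iff A).1 hgr
  simp only at hu1 hu2
  have hzero : A u - conj z • (u : E) = A 0 - conj z • ((0 : A.domain) : E) := by
    rw [hu2, hu1]; simp
  have := hA.eq_of_sub_smul_eq (z := conj z) (by simpa using hz) hzero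
  rw [← hu1, this, Submodule.coe_zero]

theorem IsSelfAdjoint.exists_isResolvent (hA : IsSelfAdjoint A) {z : ℂ} (hz : z.im ≠ 0) :
    ∃ R, IsResolvent A z R := by
  let T : A.domain →ₗ[ℂ] E := A.toFun - z • A.domain.subtype
  have hbij : Function.Bijective T :=
    ⟨fun x y h => hA.eq_of_sub_smul_eq hz h, fun η => hA.exists_sub_smul_eq hz η⟩
  let e := LinearEquiv.ofBijective T hbij
  refine ⟨(A.domain.subtype ∘ₗ e.symm.toLinearMap).mkContinuous |z.im|⁻¹ fun η => ?_, fun η =>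
    ⟨e.symm η, rfl, ?_⟩⟩
  · have h1 := hA.abs_im_mul_norm_le z (e.symm η)
    have h2 : A (e.symm η) - z • (e.symm η : E) = η := e.apply_symm_apply η
    rw [h2] at h1
    rw [inv_mul_eq_div, le_div_iff₀ (abs_pos.2 hz)]
    simp only [LinearMap.coe_comp, Function.comp_apply, LinearEquiv.coe_coe, Submodule.subtype_apply]
    linarith
  · exact e.apply_symm_apply η

namespace IsResolvent

variable {z w : ℂ} {R S : E →L[ℂ] E}

theorem apply_sub_smul (hR : IsResolvent A z R) (hA : IsSelfAdjoint A) (hz : z.im ≠ 0)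
    (x : A.domain) : R (A x - z • (x : E)) = x := by
  obtain ⟨ψ, h1, h2⟩ := hR (A x - z • (x : E))
  rw [← h1, hA.eq_of_sub_smul_eq hz h2]

theorem eq_add (hR : IsResolvent A z R) (hS : IsResolvent A w S) (hA : IsSelfAdjoint A)
    (hz : z.im ≠ 0) : S = R + (w - z) • (R * S) := by
  ext η
  obtain ⟨ψ, h1, h2⟩ := hS η
  have h3 := hR.apply_sub_smul hA hz ψ
  have h4 : A ψ - z • (ψ : E) = η + (w - z) • S η := by
    rw [← h1, sub_smul]
    nth_rw 1 [← h2]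
    abel
  rw [h4, map_add, map_smul, h1] at h3
  exact h3.symm

theorem adjoint_eq (hR : IsResolvent A z R) (hS : IsResolvent A (conj z) S)
    (hA : IsSelfAdjoint A) : star R = S := by
  rw [ContinuousLinearMap.star_eq_adjoint, eq_comm, ContinuousLinearMap.eq_adjoint_iff]
  intro x y
  obtain ⟨u, hu1, hu2⟩ := hS x
  obtain ⟨v, hv1, hv2⟩ := hR y
  rw [← hu1, ← hv1]
  nth_rw 1 [← hv2]
  nth_rw 1 [← hu2]
  rw [inner_sub_right, inner_sub_left, inner_smul_left, inner_smul_right, hA.inner_apply,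
    Complex.conj_conj]

end IsResolvent

end Resolvent

/-! ### The cyclic representation of a star homomorphism on continuous functions -/

/-- A real continuous function as a complex one. -/
def ContinuousMap.toComplex {X : Type*} [TopologicalSpace X] (f : C(X, ℝ)) : C(X, ℂ) :=
  ⟨fun x => (f x : ℂ), by fun_prop⟩

theorem inner_starAlgHom_apply {E : Type*} [NormedAddCommGroup E] [InnerProductSpace ℂ E]
    [CompleteSpace E] {X : Type*} [TopologicalSpace X]
    (Ψ : C(X, ℂ) →⋆ₐ[ℂ] (E →L[ℂ] E)) (φ : E) (f g : C(X, ℂ)) :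
    inner ℂ (Ψ f φ) (Ψ g φ) = inner ℂ φ (Ψ (star f * g) φ) := by
  rw [map_mul, map_star, mul_apply_eq_comp, ContinuousLinearMap.star_eq_adjoint,
    ContinuousLinearMap.adjoint_inner_right]

section Cyclic

open scoped CompactlySupported

variable {E : Type*} [NormedAddCommGroup E] [InnerProductSpace ℂ E] [CompleteSpace E]
  {X : Type*} [TopologicalSpace X] [CompactSpace X] [T2Space X] [MeasurableSpace X] [BorelSpace X]

/-- The functional `f ↦ ⟪φ, Ψ f φ⟫` is integration against a finite regular measure. -/
theorem exists_measure_inner_starAlgHom (Ψ : C(X, ℂ) →⋆ₐ[ℂ] (E →L[ℂ] E)) (φ : E) :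
    ∃ ν : Measure X, IsFiniteMeasure ν ∧ ν.Regular ∧
      ∀ f : C(X, ℂ), inner ℂ φ (Ψ f φ) = ∫ x, f x ∂ν := by
  let Λ₀ : C_c(X, ℝ) →ₗ[ℝ] ℝ :=
    { toFun := fun f => (inner ℂ φ (Ψ (f : C(X, ℝ)).toComplex φ)).re
      map_add' := fun f g => by
        have : ((f + g : C_c(X, ℝ)) : C(X, ℝ)).toComplex =
            (f : C(X, ℝ)).toComplex + (g : C(X, ℝ)).toComplex := by
          ext x; simp [ContinuousMap.toComplex]
        rw [this, map_add, _root_.add_apply, inner_add_right, Complex.add_re]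
      map_smul' := fun c f => by
        have : ((c • f : C_c(X, ℝ)) : C(X, ℝ)).toComplex = (c : ℂ) • (f : C(X, ℝ)).toComplex := by
          ext x; simp [ContinuousMap.toComplex]
        rw [this, map_smul, _root_.smul_apply, inner_smul_right,
          Complex.re_ofReal_mul]
        rfl }
  let Λ : C_c(X, ℝ) →ₚ[ℝ] ℝ := PositiveLinearMap.mk₀ Λ₀ fun f hf => by
    -- Positivity: with `f = star g * g` the functional equals `‖Ψ g φ‖²`.
    let g : C(X, ℂ) := ⟨fun x => (Real.sqrt (f x) : ℂ), by fun_prop⟩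
    have : (f : C(X, ℝ)).toComplex = star g * g := by
      ext x
      have h0 : 0 ≤ f x := hf x
      simp only [ContinuousMap.toComplex, ContinuousMap.coe_mk, ContinuousMap.mul_apply,
        ContinuousMap.star_apply, g, RCLike.star_def, Complex.conj_ofReal]
      rw [← Complex.ofReal_mul, Real.mul_self_sqrt h0]
    change 0 ≤ (inner ℂ φ (Ψ (f : C(X, ℝ)).toComplex φ)).re
    rw [this, ← inner_starAlgHom_apply]
    exact inner_self_nonneg (𝕜 := ℂ)
  refine ⟨RealRMK.rieszMeasure Λ, inferInstance, inferInstance, ?_⟩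
  have hreal : ∀ f : C(X, ℝ), inner ℂ φ (Ψ f.toComplex φ) =
      ((∫ x, f x ∂(RealRMK.rieszMeasure Λ) : ℝ) : ℂ) := by
    intro f
    let f' : C_c(X, ℝ) := ⟨f, HasCompactSupport.of_compactSpace _⟩
    have h1 := RealRMK.integral_rieszMeasure Λ f'
    have h2 : ∫ x, f x ∂(RealRMK.rieszMeasure Λ) = (inner ℂ φ (Ψ f.toComplex φ)).re := h1
    rw [h2]
    refine (Complex.conj_eq_iff_re.1 ?_).symm
    rw [inner_conj_symm, ← ContinuousLinearMap.adjoint_inner_right,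
      ← ContinuousLinearMap.star_eq_adjoint, ← map_star]
    congr 3
    ext x
    simp [ContinuousMap.toComplex]
  intro f
  let u : C(X, ℝ) := ⟨fun x => (f x).re, by fun_prop⟩
  let v : C(X, ℝ) := ⟨fun x => (f x).im, by fun_prop⟩
  have hf : f = u.toComplex + Complex.I • v.toComplex := by
    ext x
    simp only [ContinuousMap.toComplex, ContinuousMap.add_apply, ContinuousMap.smul_apply,
      ContinuousMap.coe_mk, u, v, smul_eq_mul]
    rw [mul_comm, Complex.re_add_im]
  have hintgr : ∀ g : C(X, ℝ), Integrable g (RealRMK.rieszMeasure Λ) := fun g =>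
    g.continuous.integrable_of_hasCompactSupport (HasCompactSupport.of_compactSpace _)
  have : ∀ x, f x = (u x : ℂ) + Complex.I * (v x : ℂ) := fun x => by
    conv_lhs => rw [hf]
    rfl
  simp_rw [this]
  rw [integral_add (hintgr u).ofReal ((hintgr v).ofReal.const_mul _), integral_const_mul,
    integral_complex_ofReal, integral_complex_ofReal, ← hreal, ← hreal]
  conv_lhs => rw [hf]
  rw [map_add, map_smul, _root_.add_apply, _root_.smul_apply,
    inner_add_right, inner_smul_right]

/-- The isometry from `L²(ν)` to the cyclic subspace of `φ`. -/
theorem exists_cyclic_isometry (Ψ : C(X, ℂ) →⋆ₐ[ℂ] (E →L[ℂ] E)) (φ : E) :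
    ∃ (ν : Measure X) (_ : IsFiniteMeasure ν) (U : Lp ℂ 2 ν →ₗᵢ[ℂ] E),
      (∀ f : C(X, ℂ), inner ℂ φ (Ψ f φ) = ∫ x, f x ∂ν) ∧
      ∀ (f : C(X, ℂ)) (g : X → ℂ) (hg : MemLp g 2 ν) (hfg : MemLp (fun x => f x * g x) 2 ν),
        Ψ f (U (hg.toLp g)) = U (hfg.toLp _) := by
  obtain ⟨ν, hν, hreg, hintgr⟩ := exists_measure_inner_starAlgHom Ψ φ
  let e : C(X, ℂ) →L[ℂ] Lp ℂ 2 ν := ContinuousMap.toLp 2 ν ℂ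
  have he : DenseRange e := ContinuousMap.toLp_denseRange ℂ ν ℂ (by norm_num)
  let F : C(X, ℂ) →ₗ[ℂ] E :=
    { toFun := fun f => Ψ f φ
      map_add' := fun f g => by simp
      map_smul' := fun c f => by simp }
  have hnorm : ∀ f, ‖F f‖ = ‖e f‖ := by
    intro f
    have h1 : inner ℂ (F f) (F f) = inner ℂ (e f) (e f) := by
      rw [ContinuousMap.inner_toLp]
      change inner ℂ (Ψ f φ) (Ψ f φ) = _
      rw [inner_starAlgHom_apply, hintgr]
      refine integral_congr_ae (Eventually.of_forall fun x => ?_)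
      simp [mul_comm]
    rw [← sq_eq_sq₀ (norm_nonneg _) (norm_nonneg _), ← inner_self_eq_norm_sq (𝕜 := ℂ), h1,
      inner_self_eq_norm_sq]
  -- The map `f ↦ Ψ f φ` is isometric for the `L²(ν)` norm on the dense image of the continuous
  -- functions, so it extends. The intertwining relation is checked on the same dense image.
  let U₀ : Lp ℂ 2 ν →L[ℂ] E := F.extendOfNorm e.toLinearMap
  have hU₀ : ∀ f, U₀ (e f) = Ψ f φ := fun f =>
    LinearMap.extendOfNorm_eq (f := F) (e := e.toLinearMap) he
      ⟨1, fun x => by rw [one_mul, hnorm x]; rfl⟩ f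
  have hU₀n : ∀ g, ‖U₀ g‖ = ‖g‖ := fun g =>
    he.induction_on (p := fun g => ‖U₀ g‖ = ‖g‖) g
      (isClosed_eq (by fun_prop) (by fun_prop)) fun f => by rw [hU₀]; exact hnorm f
  let U : Lp ℂ 2 ν →ₗᵢ[ℂ] E := ⟨U₀.toLinearMap, hU₀n⟩
  refine ⟨ν, hν, U, hintgr, fun f g hg hfg => ?_⟩
  have hfb : MemLp f ∞ ν := by
    refine memLp_top_of_bound f.continuous.aestronglyMeasurable ‖f‖
      (Eventually.of_forall fun x => f.norm_coe_le_norm x)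
  let M : Lp ℂ 2 ν →L[ℂ] Lp ℂ 2 ν :=
    (ContinuousLinearMap.mul ℂ ℂ).holderL ν ∞ 2 2 (hfb.toLp f)
  have hM : ∀ g, M g =ᵐ[ν] fun x => f x * g x := by
    intro g
    have h1 := (ContinuousLinearMap.mul ℂ ℂ).coeFn_holder (r := 2) (hfb.toLp f) g
    filter_upwards [h1, hfb.coeFn_toLp] with x hx1 hx2
    change ((ContinuousLinearMap.mul ℂ ℂ).holder 2 (hfb.toLp f) g) x = _
    rw [hx1, hx2]; rfl
  have key : ∀ g, Ψ f (U₀ g) = U₀ (M g) := fun g =>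
    he.induction_on (p := fun g => Ψ f (U₀ g) = U₀ (M g)) g
      (isClosed_eq (by fun_prop) (by fun_prop)) fun h => by
        have : M (e h) = e (f * h) := by
          refine Lp.ext ?_
          filter_upwards [hM (e h), ContinuousMap.coeFn_toLp (p := 2) (𝕜 := ℂ) ν h,
            ContinuousMap.coeFn_toLp (p := 2) (𝕜 := ℂ) ν (f * h)] with x h1 h2 h3
          rw [h1]
          change f x * (ContinuousMap.toLp 2 ν ℂ h : Lp ℂ 2 ν) x =
            (ContinuousMap.toLp 2 ν ℂ (f * h) : Lp ℂ 2 ν) x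
          rw [h2, h3]; rfl
        rw [this, hU₀, hU₀, map_mul, mul_apply_eq_comp]
  have : M (hg.toLp g) = hfg.toLp _ := by
    refine Lp.ext ?_
    filter_upwards [hM (hg.toLp g), hg.coeFn_toLp, hfg.coeFn_toLp] with x h1 h2 h3
    rw [h1, h2, h3]
  change Ψ f (U₀ (hg.toLp g)) = U₀ _
  rw [key, this]

end Cyclic

/-! ### Spectral measures of self-adjoint operators -/

section SpectralRepresentation

variable {E : Type*} [NormedAddCommGroup E] [InnerProductSpace ℂ E] [CompleteSpace E]
  {A : E →ₗ.[ℂ] E}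

theorem LinearIsometry.inner_toLp {E : Type*} [NormedAddCommGroup E] [InnerProductSpace ℂ E]
    {X : Type*} [MeasurableSpace X] {ν : Measure X}
    (U : Lp ℂ 2 ν →ₗᵢ[ℂ] E) {g h : X → ℂ} (hg : MemLp g 2 ν) (hh : MemLp h 2 ν) :
    inner ℂ (U (hg.toLp g)) (U (hh.toLp h)) = ∫ x, conj (g x) * h x ∂ν := by
  rw [U.inner_map_map, L2.inner_def]
  refine integral_congr_ae ?_
  filter_upwards [hg.coeFn_toLp, hh.coeFn_toLp] with x h1 h2
  rw [h1, h2, RCLike.inner_apply, mul_comm]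

/-- Since `1 - (z - i) a = (A - z) a`, its inverse is `(A - i)(A - z)⁻¹ = 1 + (z - i) R`. Together
with the reversed product this confines the spectrum of `a` to `0` and the inverses of numbers `x -
i` with `x` real. -/
theorem IsResolvent.one_sub_mul_one_add {z : ℂ} {a R : E →L[ℂ] E}
    (ha : IsResolvent A Complex.I a) (hR : IsResolvent A z R) (hA : IsSelfAdjoint A) :
    (1 - (z - Complex.I) • a) * (1 + (z - Complex.I) • R) = 1 := by
  have h := ha.eq_add hR hA (by simp)
  have h2 : (z - Complex.I) • R = (z - Complex.I) • a +
      (z - Complex.I) • (z - Complex.I) • (a * R) := by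
    nth_rw 1 [h]; rw [smul_add]
  rw [sub_mul, one_mul, mul_add, mul_one, smul_mul_smul_comm, mul_smul]
  nth_rw 1 [h2]
  abel

theorem IsResolvent.one_add_mul_one_sub {z : ℂ} {a R : E →L[ℂ] E}
    (ha : IsResolvent A Complex.I a) (hR : IsResolvent A z R) (hA : IsSelfAdjoint A)
    (hz : z.im ≠ 0) :
    (1 + (z - Complex.I) • R) * (1 - (z - Complex.I) • a) = 1 := by
  have h := hR.eq_add ha hA hz
  have h2 : (z - Complex.I) • a = (z - Complex.I) • R -
      (z - Complex.I) • (z - Complex.I) • (R * a) := by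
    nth_rw 1 [h]
    rw [smul_add, ← neg_sub z Complex.I, neg_smul, smul_neg, ← sub_eq_add_neg]
  rw [mul_sub, mul_one, add_mul, one_mul, smul_mul_smul_comm, mul_smul]
  nth_rw 1 [h2]
  abel

/-- The adjoint of `a` is the resolvent at `-i`. Comparing the resolvent identity with its mirror
image shows that the two commute, as `-i ≠ i`. -/
theorem IsResolvent.isStarNormal {a : E →L[ℂ] E} (ha : IsResolvent A Complex.I a)
    (hA : IsSelfAdjoint A) : IsStarNormal a := by
  obtain ⟨b, hb⟩ := hA.exists_isResolvent (z := conj Complex.I) (by simp)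
  have hab := ha.adjoint_eq hb hA
  refine ⟨?_⟩
  rw [hab]
  have h1 := ha.eq_add hb hA (by simp)
  have h2 := hb.eq_add ha hA (by simp)
  have h3 : (conj Complex.I - Complex.I) • (b * a) = (conj Complex.I - Complex.I) • (a * b) := by
    rw [eq_sub_iff_add_eq'.2 h1.symm, ← neg_sub Complex.I, neg_smul,
      eq_sub_iff_add_eq'.2 h2.symm, neg_sub]
  refine smul_right_injective _ ?_ h3
  intro h
  have := congrArg Complex.im h
  norm_num at this

/-- **Spectral theorem at a vector.** Every vector has a spectral measure `μ`, and each bounded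
Borel set carries a vector in the domain whose spectral measure is the restriction of `μ`. -/
theorem IsSelfAdjoint.exists_spectralMeasure (hA : IsSelfAdjoint A) (φ : E) :
    ∃ μ : Measure ℝ, IsSpectralMeasure A φ μ ∧
      ∀ (s : Set ℝ) (t ε : ℝ), MeasurableSet s → s ⊆ Metric.closedBall t ε → 0 ≤ ε →
        ∃ ψ : A.domain, IsSpectralMeasure A (ψ : E) (μ.restrict s) ∧
          ‖(ψ : E)‖ ^ 2 = μ.real s ∧ ‖A ψ - (t : ℂ) • (ψ : E)‖ ≤ ε * ‖(ψ : E)‖ := by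
  obtain ⟨a, ha⟩ := hA.exists_isResolvent (z := Complex.I) (by simp)
  have hnormal : IsStarNormal a := ha.isStarNormal hA
  have := IsStarNormal.instContinuousFunctionalCalculus (A := E →L[ℂ] E)
  let X := spectrum ℂ a
  let Ψ : C(X, ℂ) →⋆ₐ[ℂ] (E →L[ℂ] E) := cfcHom (R := ℂ) hnormal
  let ι : C(X, ℂ) := ContinuousMap.restrict (spectrum ℂ a) (.id ℂ)
  have hι : Ψ ι = a := cfcHom_id hnormal
  have hιr : ∀ r : X, ι r = (r : ℂ) := fun r => rfl
  obtain ⟨ν, hν, U, hintgr, hmul⟩ := exists_cyclic_isometry Ψ φ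
  have hainj : ∀ η, a η = 0 → η = 0 := by
    intro η h0
    obtain ⟨ψ, h1, h2⟩ := ha η
    rw [h0] at h1
    have : ψ = 0 := Subtype.ext h1
    rw [← h2, this]; simp
  have hspec : ∀ z : ℂ, z.im ≠ 0 → ∀ r : X, 1 - (z - Complex.I) * (r : ℂ) ≠ 0 := by
    intro z hz r h0
    obtain ⟨R, hR⟩ := hA.exists_isResolvent hz
    have hr0 : (r : ℂ) ≠ 0 := fun h => by simp [h] at h0
    have hu : IsUnit (1 - (z - Complex.I) • a) :=
      ⟨⟨_, _, ha.one_sub_mul_one_add hR hA, ha.one_add_mul_one_sub hR hA hz⟩, rfl⟩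
    have hzi : (z - Complex.I) = (r : ℂ)⁻¹ := by
      rw [sub_eq_zero] at h0
      exact eq_inv_of_mul_eq_one_left h0.symm
    have hmem := r.2
    rw [spectrum.mem_iff] at hmem
    apply hmem
    have : algebraMap ℂ (E →L[ℂ] E) (r : ℂ) - a = (r : ℂ) • (1 - (z - Complex.I) • a) := by
      rw [hzi, smul_sub, smul_smul, mul_inv_cancel₀ hr0, one_smul, Algebra.algebraMap_eq_smul_one]
    rw [this]
    exact ((isUnit_smul_iff (Units.mk0 _ hr0) _).2 hu)
  -- In the functional calculus of `a = (A - i)⁻¹`, a spectral point `r ≠ 0` corresponds to the real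
  -- point `x` of `A` with `r = (x - i)⁻¹`.
  let x : X → ℝ := fun r => ((r : ℂ)⁻¹).re
  have hxm : Measurable x := by
    exact Complex.measurable_re.comp (measurable_subtype_coe.inv)
  have hx : ∀ r : X, (r : ℂ) ≠ 0 → (r : ℂ)⁻¹ = x r - Complex.I := by
    intro r hr
    have him : ((r : ℂ)⁻¹ + Complex.I).im = 0 := by
      by_contra h
      exact hspec _ h r (by rw [add_sub_cancel_right, inv_mul_cancel₀ hr, sub_self])
    apply Complex.ext
    · simp [x]
    · simp only [Complex.add_im, Complex.I_im] at him
      simp only [Complex.sub_im, Complex.ofReal_im, Complex.I_im]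
      linarith
  let q : (z : ℂ) → z.im ≠ 0 → C(X, ℂ) := fun z hz =>
    ⟨fun r => (r : ℂ) / (1 - (z - Complex.I) * (r : ℂ)),
      Continuous.div (by fun_prop) (by fun_prop) (hspec z hz)⟩
  have hq : ∀ z (hz : z.im ≠ 0) (r : X), (r : ℂ) ≠ 0 → q z hz r = ((x r : ℂ) - z)⁻¹ := by
    intro z hz r hr
    have h1 := hx r hr
    have h2 := hspec z hz r
    have h3 : (x r : ℂ) - z = (1 - (z - Complex.I) * (r : ℂ)) / r := by
      rw [sub_div, mul_div_assoc, div_self hr, mul_one, one_div, h1]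
      ring
    rw [h3, inv_div]
    rfl
  have hqR : ∀ z (hz : z.im ≠ 0) R, IsResolvent A z R → Ψ (q z hz) = R := by
    intro z hz R hR
    have hmulq : (1 - (z - Complex.I) • ι) * q z hz = ι := by
      ext r
      change (1 - (z - Complex.I) * (r : ℂ)) * ((r : ℂ) / (1 - (z - Complex.I) * (r : ℂ))) = (r : ℂ)
      exact mul_div_cancel₀ _ (hspec z hz r)
    have h1 : (1 - (z - Complex.I) • a) * Ψ (q z hz) = a := by
      have := congrArg Ψ hmulq
      rwa [map_mul, map_sub, map_one, map_smul, hι] at this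
    have h2 : (1 - (z - Complex.I) • a) * R = a := by
      rw [sub_mul, one_mul, smul_mul_assoc, sub_eq_iff_eq_add]
      exact ha.eq_add hR hA (by simp)
    have h3 := ha.one_add_mul_one_sub hR hA hz
    calc Ψ (q z hz) = (1 + (z - Complex.I) • R) * (1 - (z - Complex.I) • a) * Ψ (q z hz) := by
          rw [h3, one_mul]
      _ = (1 + (z - Complex.I) • R) * (1 - (z - Complex.I) • a) * R := by
          rw [mul_assoc, h1, mul_assoc, h2]
      _ = R := by rw [h3, one_mul]
  have hzm : MeasurableSet {r : X | (r : ℂ) = 0} := measurable_subtype_coe (measurableSet_singleton 0)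
  -- The point `0` may belong to the spectrum of `a`, but it carries no mass: `a` annihilates the
  -- image of its indicator and is injective.
  have hzero : ∀ᵐ r : X ∂ν, (r : ℂ) ≠ 0 := by
    have hg : MemLp ({r : X | (r : ℂ) = 0}.indicator fun _ => (1 : ℂ)) 2 ν :=
      memLp_indicator_const 2 hzm 1 (Or.inr (measure_ne_top _ _))
    have h0 : (fun r : X => ι r * {r : X | (r : ℂ) = 0}.indicator (fun _ => (1 : ℂ)) r) = 0 := by
      ext r
      by_cases hr : (r : ℂ) = 0
      · simp [hιr, hr]
      · simp [hr]
    have hfg : MemLp (fun r : X => ι r * {r : X | (r : ℂ) = 0}.indicator (fun _ => (1 : ℂ)) r) 2 ν := by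
      rw [h0]; exact MemLp.zero
    have h1 := hmul ι _ hg hfg
    have h2 : hfg.toLp _ = 0 :=
      (MemLp.toLp_congr hfg MemLp.zero (Eventually.of_forall fun r => congrFun h0 r)).trans
        (MemLp.toLp_zero _)
    rw [hι, h2, map_zero] at h1
    have h3 := hainj _ h1
    have h4 := U.inner_toLp hg hg
    rw [h3, inner_zero_left] at h4
    have h5 : (fun r : X => conj ({r : X | (r : ℂ) = 0}.indicator (fun _ => (1 : ℂ)) r) *
        {r : X | (r : ℂ) = 0}.indicator (fun _ => (1 : ℂ)) r) =
        {r : X | (r : ℂ) = 0}.indicator fun _ => (1 : ℂ) := by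
      ext r
      by_cases hr : (r : ℂ) = 0 <;> simp [hr]
    rw [h5, integral_indicator_const _ hzm] at h4
    have h6 : ν.real {r : X | (r : ℂ) = 0} = 0 := by simpa using h4.symm
    have h7 : ν {r : X | (r : ℂ) = 0} = 0 := (measureReal_eq_zero_iff).1 h6
    rw [ae_iff]
    simpa using h7
  have hφ : IsSpectralMeasure A φ (ν.map x) := by
    refine ⟨inferInstance, fun z hz => ?_⟩
    obtain ⟨R, hR⟩ := hA.exists_isResolvent hz
    obtain ⟨ψ, h1, h2⟩ := hR φ
    refine ⟨ψ, h2, ?_⟩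
    rw [h1, ← hqR z hz R hR, hintgr, integral_map hxm.aemeasurable]
    · exact integral_congr_ae (hzero.mono fun r hr => hq z hz r hr)
    · exact (Measurable.inv (by fun_prop)).aestronglyMeasurable
  refine ⟨ν.map x, hφ, fun s t ε hs hst hε => ?_⟩
  have hsm : MeasurableSet (x ⁻¹' s ∩ {r : X | (r : ℂ) ≠ 0}) := (hxm hs).inter hzm.compl
  set s' : Set X := x ⁻¹' s ∩ {r : X | (r : ℂ) ≠ 0} with hs'
  have hss' : x ⁻¹' s =ᵐ[ν] s' := by
    filter_upwards [hzero] with r hr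
    exact propext ⟨fun h => ⟨h, hr⟩, fun h => h.1⟩
  -- `U g` is the spectral projection of `φ` onto `s`. Boundedness of `s` keeps `1 / r` bounded on
  -- `s'`, so `a (U g') = U g` places `U g` in the domain with `(A - i) U g = U g'`. Consequently `A
  -- - t` acts on it as multiplication by `x - t`.
  let g : X → ℂ := s'.indicator fun _ => 1
  let g' : X → ℂ := s'.indicator fun r => (r : ℂ)⁻¹
  have hg : MemLp g 2 ν := memLp_indicator_const 2 hsm 1 (Or.inr (measure_ne_top _ _))
  have hg' : MemLp g' 2 ν := by
    refine MemLp.of_bound ((measurable_subtype_coe.inv).indicator hsm).aestronglyMeasurable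
      (|t| + ε + 1) (Eventually.of_forall fun r => ?_)
    by_cases hr : r ∈ s'
    · simp only [g', Set.indicator_of_mem hr]
      have hd : |x r - t| ≤ ε := by simpa [Real.dist_eq] using hst hr.1
      rw [hx r hr.2]
      refine (norm_sub_le _ _).trans ?_
      rw [Complex.norm_I, Complex.norm_real, Real.norm_eq_abs]
      have := abs_sub_abs_le_abs_sub (x r) t
      linarith
    · simp only [g', Set.indicator_of_notMem hr, norm_zero]
      positivity
  have hιg : (fun r => ι r * g' r) = g := by
    ext r
    by_cases hr : r ∈ s'
    · simp only [g, g', Set.indicator_of_mem hr, hιr]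
      exact mul_inv_cancel₀ hr.2
    · simp [g, g', Set.indicator_of_notMem hr]
  have hag : a (U (hg'.toLp g')) = U (hg.toLp g) := by
    have h := hmul ι g' hg' (by rw [hιg]; exact hg)
    rw [hι] at h
    rw [h]
    congr 1
    exact MemLp.toLp_congr _ _ (Eventually.of_forall fun r => congrFun hιg r)
  obtain ⟨ψ, hψ1, hψ2⟩ := ha (U (hg'.toLp g'))
  rw [hag] at hψ1
  have hgg : ∀ f : X → ℂ, (fun r => conj (g r) * (f r * g r)) = s'.indicator f := by
    intro f
    ext r
    by_cases hr : r ∈ s' <;> simp [g, hr]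
  have hnorm : ‖(ψ : E)‖ ^ 2 = (ν.map x).real s := by
    have h1 := U.inner_toLp hg hg
    have h2 := hgg fun _ => 1
    simp only [one_mul] at h2
    rw [h2, integral_indicator_const _ hsm, ← hψ1, inner_self_eq_norm_sq_to_K] at h1
    rw [map_measureReal_apply hxm hs, measureReal_congr hss']
    have h3 : ((‖(ψ : E)‖ ^ 2 : ℝ) : ℂ) = ((ν.real s' : ℝ) : ℂ) := by
      push_cast
      simpa using h1
    exact_mod_cast h3
  refine ⟨ψ, ⟨inferInstance, fun z hz => ?_⟩, hnorm, ?_⟩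
  · obtain ⟨R, hR⟩ := hA.exists_isResolvent hz
    obtain ⟨ξ, h1, h2⟩ := hR (ψ : E)
    refine ⟨ξ, h2, ?_⟩
    have hqg : MemLp (fun r => q z hz r * g r) 2 ν := by
      refine MemLp.of_bound ((q z hz).continuous.measurable.mul
        (measurable_const.indicator hsm)).aestronglyMeasurable ‖q z hz‖
        (Eventually.of_forall fun r => ?_)
      rw [norm_mul]
      refine mul_le_of_le_one_right (norm_nonneg _) ?_ |>.trans ((q z hz).norm_coe_le_norm r)
      by_cases hr : r ∈ s' <;> simp [g, hr]
    have hm : Measurable fun y : ℝ => ((y : ℂ) - z)⁻¹ := Measurable.inv (by fun_prop)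
    rw [h1, hψ1, ← hqR z hz R hR, hmul (q z hz) g hg hqg, U.inner_toLp hg hqg, hgg,
      integral_indicator hsm, Measure.restrict_map hxm hs, integral_map hxm.aemeasurable
      hm.aestronglyMeasurable, Measure.restrict_congr_set hss']
    exact setIntegral_congr_fun hsm fun r hr => hq z hz r hr.2
  · have hsub : A ψ - (t : ℂ) • (ψ : E) =
        U (hg'.toLp g' + (Complex.I - t) • hg.toLp g) := by
      rw [map_add, map_smul, ← hψ2, ← hψ1, sub_smul]
      abel
    rw [hsub, hψ1, U.norm_map, U.norm_map, ← MemLp.toLp_const_smul, ← MemLp.toLp_add]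
    refine Lp.norm_le_mul_norm_of_ae_le_mul ?_
    filter_upwards [hg.coeFn_toLp, (hg'.add (hg.const_smul (Complex.I - (t : ℂ)))).coeFn_toLp]
      with r h1 h2
    rw [h1, h2]
    by_cases hr : r ∈ s'
    · have hd : |x r - t| ≤ ε := by simpa [Real.dist_eq] using hst hr.1
      simp only [g, g', Pi.add_apply, Pi.smul_apply, Set.indicator_of_mem hr, smul_eq_mul, mul_one,
        norm_one]
      rw [hx r hr.2, sub_add_sub_cancel, ← Complex.ofReal_sub, Complex.norm_real, Real.norm_eq_abs]
      exact hd
    · simp [g, g', Set.indicator_of_notMem hr]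

end SpectralRepresentation

/-! ### The absolutely continuous part of a spectral measure -/

/-- A finite measure agrees with its absolutely continuous part on a Borel set whose complement is
a Lebesgue null set. -/
theorem exists_measure_eq_acPart (μ : Measure ℝ) [IsFiniteMeasure μ] :
    ∃ S : Set ℝ, MeasurableSet S ∧ volume Sᶜ = 0 ∧ ∀ s ⊆ S, μ s = acPart μ s := by
  have hsing := Measure.mutuallySingular_singularPart μ volume
  refine ⟨hsing.nullSet, hsing.measurableSet_nullSet, hsing.measure_compl_nullSet, fun s hs => ?_⟩
  conv_lhs => rw [Measure.haveLebesgueDecomposition_add μ volume]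
  rw [Measure.add_apply, measure_mono_null hs hsing.measure_nullSet, zero_add, acPart]

theorem acPart_absolutelyContinuous (μ : Measure ℝ) : acPart μ ≪ volume :=
  withDensity_absolutelyContinuous _ _

/-- If the absolutely continuous part vanished near a point of `(a, b)`, inner regularity would give
a compact set of positive Lebesgue measure near that point, inside the set where `μ` and its
absolutely continuous part agree. It would be `μ`-null. -/
theorem Icc_subset_support_acPart (μ : Measure ℝ) [IsFiniteMeasure μ] {a b : ℝ} (hab : a < b)
    (h : ∀ K : Set ℝ, IsCompact K → K ⊆ Set.Ioo a b → 0 < volume K → μ K ≠ 0) :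
    Set.Icc a b ⊆ (acPart μ).support := by
  rw [← closure_Ioo hab.ne]
  refine closure_minimal (fun t ht => ?_) Measure.isClosed_support
  rw [Measure.mem_support_iff_forall]
  intro U hU
  by_contra h0
  replace h0 : acPart μ U = 0 := by simpa using h0
  obtain ⟨S, hSm, hS0, hS⟩ := exists_measure_eq_acPart μ
  obtain ⟨V, hVU, hVo, htV⟩ := mem_nhds_iff.1 (inter_mem hU (Ioo_mem_nhds ht.1 ht.2))
  have hVS : volume (V ∩ S) = volume V := measure_inter_conull hS0
  have hpos : 0 < volume (V ∩ S) := by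
    rw [hVS]; exact hVo.measure_pos volume ⟨t, htV⟩
  obtain ⟨K, hK, hKc, hKpos⟩ := (hVo.measurableSet.inter hSm).exists_lt_isCompact hpos
  refine h K hKc (fun x hx => (hVU (hK hx).1).2) hKpos ?_
  rw [hS K fun x hx => (hK hx).2]
  exact measure_mono_null (fun x hx => (hVU (hK hx).1).1) h0

section

variable {E : Type*} [NormedAddCommGroup E] [InnerProductSpace ℂ E] [CompleteSpace E]
  {A : E →ₗ.[ℂ] E}

theorem IsSpectralMeasure.unique (hA : IsSelfAdjoint A) {φ : E} {μ ν : Measure ℝ}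
    (hμ : IsSpectralMeasure A φ μ) (hν : IsSpectralMeasure A φ ν) : μ = ν := by
  have := hμ.1
  have := hν.1
  refine measure_eq_of_stieltjesTransform_eq fun z hz => ?_
  obtain ⟨ψ, h1, h2⟩ := hμ.2 z hz.ne'
  obtain ⟨ξ, h3, h4⟩ := hν.2 z hz.ne'
  rw [stieltjesTransform, stieltjesTransform, ← h2, ← h4,
    hA.eq_of_sub_smul_eq hz.ne' (h1.trans h3.symm)]

theorem isSpectralMeasure_spectralMeasure (hA : IsSelfAdjoint A) (φ : E) :
    IsSpectralMeasure A φ (spectralMeasure A φ) := by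
  obtain ⟨μ, hμ, -⟩ := hA.exists_spectralMeasure φ
  have h : ∃ μ, IsSpectralMeasure A φ μ := ⟨μ, hμ⟩
  rw [spectralMeasure, dif_pos h]
  exact h.choose_spec

/-- A bounded inverse with constant `C` is refuted by an approximate eigenvector: the spectral
projection of `φ` onto an `ε`-ball around `t`, intersected with the set where `μ` is absolutely
continuous. It is non-zero, lies in the absolutely continuous subspace, and `ε` is chosen with `|C|
ε < 1`. -/
theorem support_acPart_spectralMeasure_subset (hA : IsSelfAdjoint A) (φ : E) :
    (acPart (spectralMeasure A φ)).support ⊆ acSpectrum A := by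
  obtain ⟨μ, hμ, hvec⟩ := hA.exists_spectralMeasure φ
  rw [(isSpectralMeasure_spectralMeasure hA φ).unique hA hμ]
  have := hμ.1
  rintro t ht ⟨-, C, hC⟩
  set ε : ℝ := 1 / (|C| + 1) with hε
  have hεpos : 0 < ε := by positivity
  have hCε : |C| * ε < 1 := by
    rw [hε, mul_one_div, div_lt_one (by positivity)]
    linarith
  have hball : 0 < acPart μ (Metric.closedBall t ε) :=
    (Measure.mem_support_iff_forall t).1 ht _ (Metric.closedBall_mem_nhds t hεpos)
  obtain ⟨S, hSm, hS0, hS⟩ := exists_measure_eq_acPart μ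
  set s := Metric.closedBall t ε ∩ S with hs
  have hsm : MeasurableSet s := Metric.isClosed_closedBall.measurableSet.inter hSm
  obtain ⟨ψ, hψ, hnorm, hle⟩ := hvec s t ε hsm Set.inter_subset_left hεpos.le
  have hac : μ.restrict s ≪ volume := by
    refine Measure.AbsolutelyContinuous.mk fun u hu hu0 => ?_
    rw [Measure.restrict_apply hu, hS _ (Set.inter_subset_right.trans Set.inter_subset_right)]
    exact measure_mono_null Set.inter_subset_left (acPart_absolutelyContinuous μ hu0)
  have hpos : 0 < μ s := by
    rwa [hS s Set.inter_subset_right, hs,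
      measure_inter_conull (acPart_absolutelyContinuous μ hS0)]
  have hψpos : 0 < ‖(ψ : E)‖ := by
    refine (norm_nonneg _).lt_of_ne fun h0 => ?_
    rw [← h0] at hnorm
    have : μ.real s = 0 := by rw [← hnorm]; norm_num
    exact hpos.ne' ((measureReal_eq_zero_iff).1 this)
  have h1 := hC ψ ⟨_, hψ, hac⟩
  have h2 : C * ‖A ψ - (t : ℂ) • (ψ : E)‖ ≤ |C| * (ε * ‖(ψ : E)‖) :=
    mul_le_mul (le_abs_self C) hle (norm_nonneg _) (abs_nonneg C)
  nlinarith

end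

/-! ### Dissipative perturbations of Hermitian matrices -/


theorem star_dotProduct_eq_inner {ι : Type*} [Fintype ι] (v w : ι → ℂ) :
    star v ⬝ᵥ w = inner ℂ (WithLp.toLp 2 v) (WithLp.toLp 2 w) := by
  rw [EuclideanSpace.inner_toLp_toLp, dotProduct_comm]

theorem star_dotProduct_self {ι : Type*} [Fintype ι] (v : ι → ℂ) :
    star v ⬝ᵥ v = ((‖WithLp.toLp 2 v‖ ^ 2 : ℝ) : ℂ) := by
  rw [star_dotProduct_eq_inner, inner_self_eq_norm_sq_to_K]
  push_cast
  rfl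

section Dissipative

variable {ι κ : Type*} [Fintype ι] [DecidableEq ι] [Fintype κ]

/-- The Hermitian matrix `H` with the dissipative boundary term `-i Φ Φ^*`. -/
def dissipative (H : Matrix ι ι ℂ) (Φ : Matrix ι κ ℂ) : Matrix ι ι ℂ :=
  H - Complex.I • (Φ * Φᴴ)

/-- The matrix element of the resolvent of `dissipative H Φ` at the vector `u`. -/
def dissipativeM (H : Matrix ι ι ℂ) (Φ : Matrix ι κ ℂ) (u : ι → ℂ) (z : ℂ) : ℂ :=
  star u ⬝ᵥ ((dissipative H Φ - z • 1)⁻¹ *ᵥ u)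

variable {H : Matrix ι ι ℂ}

theorem im_dotProduct_dissipative (hH : H.IsHermitian) (Φ : Matrix ι κ ℂ) (z : ℂ) (v : ι → ℂ) :
    (star v ⬝ᵥ ((dissipative H Φ - z • 1) *ᵥ v)).im =
      -(‖WithLp.toLp 2 (Φᴴ *ᵥ v)‖ ^ 2 + z.im * ‖WithLp.toLp 2 v‖ ^ 2) := by
  have h1 : (star v ⬝ᵥ (H *ᵥ v)).im = 0 := hH.im_star_dotProduct_mulVec_self v
  have h2 : star v ⬝ᵥ ((Φ * Φᴴ) *ᵥ v) = ((‖WithLp.toLp 2 (Φᴴ *ᵥ v)‖ ^ 2 : ℝ) : ℂ) := by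
    rw [← star_dotProduct_self, ← mulVec_mulVec, dotProduct_mulVec, star_mulVec,
      conjTranspose_conjTranspose]
  rw [dissipative, sub_mulVec, sub_mulVec, smul_mulVec, smul_mulVec, one_mulVec, dotProduct_sub,
    dotProduct_sub, dotProduct_smul, dotProduct_smul, h2, star_dotProduct_self, Complex.sub_im,
    Complex.sub_im, h1]
  simp only [smul_eq_mul, Complex.mul_im, Complex.I_re, Complex.I_im, Complex.ofReal_im,
    Complex.ofReal_re]
  ring

theorem isUnit_det_dissipative (hH : H.IsHermitian) (Φ : Matrix ι κ ℂ) {z : ℂ} (hz : 0 < z.im) :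
    IsUnit (dissipative H Φ - z • 1).det := by
  rw [isUnit_iff_ne_zero]
  intro h0
  obtain ⟨v, hv, hv0⟩ := Matrix.exists_mulVec_eq_zero_iff.2 h0
  have h := im_dotProduct_dissipative hH Φ z v
  rw [hv0, dotProduct_zero, Complex.zero_im] at h
  have h1 : 0 < ‖WithLp.toLp 2 v‖ := by
    rw [norm_pos_iff]
    intro h
    exact hv (by simpa using h)
  have h2 : 0 < z.im * ‖WithLp.toLp 2 v‖ ^ 2 := by positivity
  nlinarith [sq_nonneg ‖WithLp.toLp 2 (Φᴴ *ᵥ v)‖]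

/-- For a kernel vector `v` at real `t`, the imaginary part of the quadratic form forces `Φ^* v =
0`. Then the dissipative term drops out and `(H - t) v = 0`. -/
theorem isUnit_det_dissipative_ofReal (hH : H.IsHermitian) (Φ : Matrix ι κ ℂ) {t : ℝ} (ht : (H - (t : ℂ) • 1).det ≠ 0) :
    IsUnit (dissipative H Φ - (t : ℂ) • 1).det := by
  rw [isUnit_iff_ne_zero]
  intro h0
  obtain ⟨v, hv, hv0⟩ := Matrix.exists_mulVec_eq_zero_iff.2 h0
  have h := im_dotProduct_dissipative hH Φ t v
  rw [hv0, dotProduct_zero, Complex.zero_im, Complex.ofReal_im, zero_mul, add_zero] at h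
  have h1 : ‖WithLp.toLp 2 (Φᴴ *ᵥ v)‖ = 0 := by nlinarith [norm_nonneg (WithLp.toLp 2 (Φᴴ *ᵥ v))]
  have h2 : Φᴴ *ᵥ v = 0 := by simpa using h1
  refine ht (Matrix.exists_mulVec_eq_zero_iff.1 ⟨v, hv, ?_⟩)
  rw [dissipative, sub_sub, add_comm, ← sub_sub, sub_mulVec _ (Complex.I • _), smul_mulVec,
    ← mulVec_mulVec, h2, mulVec_zero, smul_zero, sub_zero] at hv0
  exact hv0

theorem im_dissipativeM (hH : H.IsHermitian) (Φ : Matrix ι κ ℂ) (u : ι → ℂ) {z : ℂ} (hz : IsUnit (dissipative H Φ - z • 1).det) :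
    (dissipativeM H Φ u z).im =
      ‖WithLp.toLp 2 (Φᴴ *ᵥ ((dissipative H Φ - z • 1)⁻¹ *ᵥ u))‖ ^ 2 +
        z.im * ‖WithLp.toLp 2 ((dissipative H Φ - z • 1)⁻¹ *ᵥ u)‖ ^ 2 := by
  set v := (dissipative H Φ - z • 1)⁻¹ *ᵥ u with hv
  have hu : (dissipative H Φ - z • 1) *ᵥ v = u := by
    rw [hv, mulVec_mulVec, Matrix.mul_nonsing_inv _ hz, one_mulVec]
  have h := im_dotProduct_dissipative hH Φ z v
  rw [hu, star_dotProduct_eq_inner, ← inner_conj_symm, Complex.conj_im, neg_inj,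
    ← star_dotProduct_eq_inner] at h
  exact h

theorem norm_inv_dissipative_mulVec_le (hH : H.IsHermitian) (Φ : Matrix ι κ ℂ) (u : ι → ℂ) {z : ℂ} (hz : 0 < z.im) :
    ‖WithLp.toLp 2 ((dissipative H Φ - z • 1)⁻¹ *ᵥ u)‖ ≤ ‖WithLp.toLp 2 u‖ / z.im := by
  have h := im_dissipativeM hH Φ u (isUnit_det_dissipative hH Φ hz)
  set v := (dissipative H Φ - z • 1)⁻¹ *ᵥ u
  have h1 : (dissipativeM H Φ u z).im ≤ ‖WithLp.toLp 2 u‖ * ‖WithLp.toLp 2 v‖ := by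
    refine (le_abs_self _).trans ((Complex.abs_im_le_norm _).trans ?_)
    rw [dissipativeM, star_dotProduct_eq_inner]
    exact norm_inner_le_norm _ _
  rw [le_div_iff₀ hz]
  rcases (norm_nonneg (WithLp.toLp 2 v)).eq_or_lt with h0 | h0
  · rw [← h0, zero_mul]; exact norm_nonneg _
  · nlinarith [sq_nonneg ‖WithLp.toLp 2 (Φᴴ *ᵥ v)‖]

theorem dissipativeM_eq_sum (H : Matrix ι ι ℂ) (Φ : Matrix ι κ ℂ) (u : ι → ℂ) (z : ℂ) :
    dissipativeM H Φ u z = ∑ i, star (u i) * ∑ j, ((dissipative H Φ - z • 1).det)⁻¹ *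
      (dissipative H Φ - z • 1).adjugate i j * u j := by
  simp [dissipativeM, Matrix.inv_def, dotProduct, mulVec, Ring.inverse_eq_inv']

theorem measurable_dissipativeM (Φ : Matrix ι κ ℂ) (H : Matrix ι ι ℂ) (u : ι → ℂ) :
    Measurable (dissipativeM H Φ u) := by
  rw [funext (dissipativeM_eq_sum H Φ u)]
  have hc : Continuous fun z : ℂ => dissipative H Φ - z • (1 : Matrix ι ι ℂ) := by fun_prop
  refine Finset.measurable_sum _ fun i _ => Measurable.const_mul
    (Finset.measurable_sum _ fun j _ => Measurable.mul_const (Measurable.mul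
      hc.matrix_det.measurable.inv (hc.matrix_adjugate.matrix_elem i j).measurable) _) _

theorem differentiable_det {M : ℂ → Matrix ι ι ℂ}
    (hM : ∀ i j, Differentiable ℂ fun z => M z i j) : Differentiable ℂ fun z => (M z).det := by
  simp_rw [Matrix.det_apply]
  fun_prop

theorem differentiableAt_dissipativeM (Φ : Matrix ι κ ℂ) (H : Matrix ι ι ℂ) (u : ι → ℂ) {z : ℂ}
    (hz : IsUnit (dissipative H Φ - z • 1).det) :
    DifferentiableAt ℂ (dissipativeM H Φ u) z := by
  have hent : ∀ i j, Differentiable ℂ fun z : ℂ => (dissipative H Φ - z • (1 : Matrix ι ι ℂ)) i j := by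
    intro i j
    simp only [Matrix.sub_apply, Matrix.smul_apply, smul_eq_mul]
    fun_prop
  have hdet := differentiable_det hent
  have hadj : ∀ i j, Differentiable ℂ fun z : ℂ =>
      (dissipative H Φ - z • (1 : Matrix ι ι ℂ)).adjugate i j := by
    intro i j
    simp_rw [adjugate_apply]
    refine differentiable_det fun k l => ?_
    simp only [updateRow_apply]
    split_ifs
    · fun_prop
    · exact hent k l
  rw [funext (dissipativeM_eq_sum H Φ u)]
  refine DifferentiableAt.fun_sum fun i _ => DifferentiableAt.const_mul
    (DifferentiableAt.fun_sum fun j _ => DifferentiableAt.mul_const (DifferentiableAt.mul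
      ((hdet z).inv (isUnit_iff_ne_zero.1 hz)) (hadj i j z)) _) _

theorem isHerglotz_dissipativeM (hH : H.IsHermitian) (Φ : Matrix ι κ ℂ) (u : ι → ℂ) :
    IsHerglotz (dissipativeM H Φ u) (‖WithLp.toLp 2 u‖ ^ 2) where
  differentiableAt z hz := differentiableAt_dissipativeM Φ H u (isUnit_det_dissipative hH Φ hz)
  im_nonneg z hz := by
    rw [im_dissipativeM hH Φ u (isUnit_det_dissipative hH Φ hz)]
    positivity
  norm_le z hz := by
    rw [dissipativeM, star_dotProduct_eq_inner]
    refine (norm_inner_le_norm _ _).trans ?_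
    have := norm_inv_dissipative_mulVec_le hH Φ u hz
    calc _ ≤ ‖WithLp.toLp 2 u‖ * (‖WithLp.toLp 2 u‖ / z.im) := by gcongr
      _ = _ := by ring

theorem tendsto_im_dissipativeM (hH : H.IsHermitian) (Φ : Matrix ι κ ℂ) (u : ι → ℂ) {t : ℝ} (ht : (H - (t : ℂ) • 1).det ≠ 0) :
    Tendsto (fun ε : ℝ => (dissipativeM H Φ u (t + ε * Complex.I)).im) (𝓝[>] 0)
      (𝓝 (dissipativeM H Φ u t).im) := by
  have h1 := (differentiableAt_dissipativeM Φ H u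
    (isUnit_det_dissipative_ofReal hH Φ ht)).continuousAt
  have h2 : Tendsto (fun ε : ℝ => (t : ℂ) + ε * Complex.I) (𝓝[>] 0) (𝓝 (t : ℂ)) := by
    refine tendsto_nhdsWithin_of_tendsto_nhds ?_
    have : Continuous fun ε : ℝ => (t : ℂ) + ε * Complex.I := by fun_prop
    simpa using this.tendsto 0
  exact (Complex.continuous_im.tendsto _).comp (h1.tendsto.comp h2)

theorem ae_det_sub_smul_ne_zero (H : Matrix ι ι ℂ) : ∀ᵐ t : ℝ, (H - (t : ℂ) • 1).det ≠ 0 := by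
  have hfin : {z : ℂ | H.charpoly.IsRoot z}.Finite :=
    Polynomial.finite_setOfPred_isRoot H.charpoly_monic.ne_zero
  have hfin' : {t : ℝ | H.charpoly.IsRoot (t : ℂ)}.Finite :=
    hfin.preimage Complex.ofReal_injective.injOn
  filter_upwards [hfin'.countable.ae_notMem volume] with t ht h0
  apply ht
  change H.charpoly.eval (t : ℂ) = 0
  rw [Matrix.eval_charpoly, ← neg_sub, Matrix.det_neg, Matrix.scalar_apply,
    ← Matrix.smul_one_eq_diagonal, h0, mul_zero]

/-- Put `p = Φ^* (H - iΦΦ^* - t)⁻¹ u`, so that the imaginary part is `‖p‖²`. The resolvent identity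
gives `Φ^* (H - t)⁻¹ u = (1 - iδ) p`, and the hypothesis on `B` becomes `⟨p, (1 + iδ) B⟩ = 1`. As
`δ` is Hermitian, `‖(1 + iδ) B‖² = ‖B‖² + ‖δ B‖²`, and Cauchy-Schwarz concludes. -/
theorem one_le_im_dissipativeM_mul (hH : H.IsHermitian) (Φ : Matrix ι κ ℂ) (u : ι → ℂ) {t : ℝ} (ht : (H - (t : ℂ) • 1).det ≠ 0)
    {B : κ → ℂ} (hB : (star u ᵥ* ((H - (t : ℂ) • 1)⁻¹ * Φ)) ⬝ᵥ B = 1) :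
    1 ≤ (dissipativeM H Φ u t).im * (‖WithLp.toLp 2 B‖ ^ 2 +
      ‖WithLp.toLp 2 ((Φᴴ * (H - (t : ℂ) • 1)⁻¹ * Φ) *ᵥ B)‖ ^ 2) := by
  have hu := isUnit_det_dissipative_ofReal hH Φ ht
  have htu : IsUnit (H - (t : ℂ) • 1).det := isUnit_iff_ne_zero.2 ht
  rw [im_dissipativeM hH Φ u hu, Complex.ofReal_im, zero_mul, add_zero]
  obtain ⟨v, hv⟩ : ∃ v, v = (dissipative H Φ - (t : ℂ) • 1)⁻¹ *ᵥ u := ⟨_, rfl⟩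
  rw [← hv]
  obtain ⟨p, hp⟩ : ∃ p, p = Φᴴ *ᵥ v := ⟨_, rfl⟩
  rw [← hp]
  have hHt : (H - (t : ℂ) • 1).IsHermitian := by
    refine hH.sub ?_
    rw [Matrix.IsHermitian, conjTranspose_smul, conjTranspose_one, RCLike.star_def,
      Complex.conj_ofReal]
  set G := (H - (t : ℂ) • 1)⁻¹ with hG
  have hGh : Gᴴ = G := hHt.inv
  set δ := Φᴴ * G * Φ with hδ
  have hδh : δᴴ = δ := by
    rw [hδ, conjTranspose_mul, conjTranspose_mul, hGh, conjTranspose_conjTranspose, Matrix.mul_assoc]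
  have huv : (dissipative H Φ - (t : ℂ) • 1) *ᵥ v = u := by
    rw [hv, mulVec_mulVec, Matrix.mul_nonsing_inv _ hu, one_mulVec]
  have huv' : u = (H - (t : ℂ) • 1) *ᵥ v - Complex.I • (Φ *ᵥ p) := by
    rw [← huv, dissipative, hp, mulVec_mulVec, ← smul_mulVec, ← sub_mulVec, sub_right_comm]
  have hGu : G *ᵥ u = v - Complex.I • ((G * Φ) *ᵥ p) := by
    rw [huv', mulVec_sub, mulVec_mulVec, hG, Matrix.nonsing_inv_mul _ htu, one_mulVec,
      mulVec_smul, mulVec_mulVec]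
  have hγ : Φᴴ *ᵥ (G *ᵥ u) = p - Complex.I • (δ *ᵥ p) := by
    rw [hGu, mulVec_sub, mulVec_smul, ← hp, mulVec_mulVec, hδ, Matrix.mul_assoc]
  have hB' : star p ⬝ᵥ (B + Complex.I • (δ *ᵥ B)) = 1 := by
    have h1 : star u ᵥ* (G * Φ) = star (Φᴴ *ᵥ (G *ᵥ u)) := by
      rw [star_mulVec, star_mulVec, hGh, conjTranspose_conjTranspose, vecMul_vecMul]
    rw [h1, hγ, star_sub, star_smul, star_mulVec, hδh, sub_dotProduct, smul_dotProduct,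
      ← dotProduct_mulVec] at hB
    rw [dotProduct_add, dotProduct_smul, ← hB]
    simp [sub_eq_add_neg]
  have hnorm : ‖WithLp.toLp 2 (B + Complex.I • (δ *ᵥ B))‖ ^ 2 =
      ‖WithLp.toLp 2 B‖ ^ 2 + ‖WithLp.toLp 2 (δ *ᵥ B)‖ ^ 2 := by
    rw [WithLp.toLp_add, WithLp.toLp_smul, norm_add_sq (𝕜 := ℂ), norm_smul, Complex.norm_I, one_mul,
      inner_smul_right, ← star_dotProduct_eq_inner]
    have h0 : (star B ⬝ᵥ (δ *ᵥ B)).im = 0 := by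
      have : star B ⬝ᵥ (δ *ᵥ B) = conj (star B ⬝ᵥ (δ *ᵥ B)) := by
        conv_rhs => rw [star_dotProduct_eq_inner, inner_conj_symm, ← star_dotProduct_eq_inner,
          star_mulVec, hδh, ← dotProduct_mulVec]
      exact Complex.conj_eq_iff_im.1 this.symm
    simp [h0]
  rw [← hnorm, ← mul_pow]
  have h1 : (1 : ℝ) ≤ ‖WithLp.toLp 2 p‖ * ‖WithLp.toLp 2 (B + Complex.I • (δ *ᵥ B))‖ := by
    have := norm_inner_le_norm (𝕜 := ℂ) (WithLp.toLp 2 p) (WithLp.toLp 2 (B + Complex.I • (δ *ᵥ B)))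
    rwa [← star_dotProduct_eq_inner, hB', norm_one] at this
  exact one_le_pow₀ h1

end Dissipative

/-! ### Essentially self-adjoint operators -/

section EssentiallySelfAdjoint

variable {E : Type*} [NormedAddCommGroup E] [InnerProductSpace ℂ E] [CompleteSpace E]
  {A : E →ₗ.[ℂ] E}

theorem IsSelfAdjoint.isClosable_of_closure (hA : IsSelfAdjoint A.closure) : A.IsClosable :=
  hA.isClosed.isClosable.leIsClosable A.le_closure

theorem IsSelfAdjoint.exists_approx (hA : IsSelfAdjoint A.closure) (ψ : A.closure.domain) {d : ℝ}
    (hd : 0 < d) : ∃ η : A.domain, ‖(η : E) - ψ‖ < d ∧ ‖A η - A.closure ψ‖ < d := by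
  have hg := hA.isClosable_of_closure.graph_closure_eq_closure_graph
  have hmem : ((ψ : E), A.closure ψ) ∈ A.graph.topologicalClosure := by
    rw [hg]; exact LinearPMap.mem_graph _ ψ
  obtain ⟨⟨x, y⟩, hp, hdist⟩ := Metric.mem_closure_iff.1 hmem d hd
  obtain ⟨u, hu1, hu2⟩ := (LinearPMap.mem_graph_iff A).1 hp
  simp only at hu1 hu2
  subst hu1
  subst hu2
  rw [dist_comm, Prod.dist_eq, max_lt_iff] at hdist
  exact ⟨u, by simpa [dist_eq_norm] using hdist.1, by simpa [dist_eq_norm] using hdist.2⟩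

theorem IsSelfAdjoint.dense_domain_of_closure (hA : IsSelfAdjoint A.closure) :
    Dense (A.domain : Set E) := by
  refine Dense.of_closure (hA.dense_domain.mono fun x hx => Metric.mem_closure_iff.2 fun d hd => ?_)
  obtain ⟨η, hη, -⟩ := hA.exists_approx ⟨x, hx⟩ hd
  exact ⟨η, η.2, by rwa [dist_comm, dist_eq_norm]⟩

/-- The formal adjoint relation between `A` and its adjoint extends by continuity to the closure of
the graph, so the adjoint is contained in the adjoint of the closure, which is the closure itself.
The other inclusion is the symmetry of the closure. -/
theorem IsSelfAdjoint.adjoint_eq_closure (hA : IsSelfAdjoint A.closure) :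
    A.adjoint = A.closure := by
  have hdense := hA.dense_domain_of_closure
  refine le_antisymm ?_ ?_
  · have h : A.closure.IsFormalAdjoint A.adjoint := by
      intro x y
      have hcl : IsClosed {p : E × E | inner ℂ p.2 (y : E) = inner ℂ p.1 (A.adjoint y)} :=
        isClosed_eq (by fun_prop) (by fun_prop)
      have hsub : (A.graph : Set (E × E)) ⊆
          {p : E × E | inner ℂ p.2 (y : E) = inner ℂ p.1 (A.adjoint y)} := by
        rintro ⟨p, q⟩ hp
        obtain ⟨u, hu1, hu2⟩ := (LinearPMap.mem_graph_iff A).1 hp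
        simp only at hu1 hu2
        subst hu1
        subst hu2
        exact (LinearPMap.adjoint_isFormalAdjoint hdense).symm u y
      have hmem : ((x : E), A.closure x) ∈ A.graph.topologicalClosure := by
        rw [hA.isClosable_of_closure.graph_closure_eq_closure_graph]
        exact LinearPMap.mem_graph _ x
      exact closure_minimal hsub hcl hmem
    have := h.le_adjoint hA.dense_domain
    rwa [LinearPMap.isSelfAdjoint_def.1 hA] at this
  · refine LinearPMap.IsFormalAdjoint.le_adjoint hdense fun x y => ?_
    have hx : (x : E) ∈ A.closure.domain := A.le_closure.1 x.2
    have h1 : A x = A.closure ⟨x, hx⟩ := A.le_closure.2 rfl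
    rw [h1]
    exact hA.inner_apply ⟨x, hx⟩ y

end EssentiallySelfAdjoint

/-! ### Convergence of the dissipative truncations -/

namespace ShellOperator

variable {𝔾 : Type*} (D : ShellOperator 𝔾)

/-- The restriction of a function to the shells `0, …, n`. -/
def restrictTo (n : ℕ) (ζ : 𝔾 → ℂ) : D.G 0 n → ℂ := fun x => ζ x

theorem norm_restrictTo_le (n : ℕ) (ζ : HilbertSpace 𝔾) :
    ‖WithLp.toLp 2 (D.restrictTo n ζ)‖ ≤ ‖ζ‖ := by
  rw [← sq_le_sq₀ (norm_nonneg _) (norm_nonneg _), EuclideanSpace.norm_sq_eq]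
  have h := lp.sum_rpow_le_norm_rpow (p := 2) (by norm_num) ζ
    ((Finset.univ : Finset (D.G 0 n)).map (Function.Embedding.subtype _))
  simpa [restrictTo] using h

theorem star_restrictTo_dotProduct {n : ℕ} {ζ : HilbertSpace 𝔾} (hζ : ∀ x, n < D.shell x → ζ x = 0)
    (ξ : HilbertSpace 𝔾) :
    star (D.restrictTo n ζ) ⬝ᵥ D.restrictTo n ξ = inner ℂ ζ ξ := by
  rw [lp.inner_eq_tsum, ← tsum_subtype_eq_of_support_subset
    (s := {x | 0 ≤ D.shell x ∧ D.shell x ≤ n})]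
  · rw [show (∑' x : {x | 0 ≤ D.shell x ∧ D.shell x ≤ n}, inner ℂ (ζ x) (ξ x)) =
      ∑' x : D.G 0 n, inner ℂ (ζ x) (ξ x) from rfl, tsum_fintype]
    simp [dotProduct, restrictTo, mul_comm]
  · intro x hx
    refine ⟨zero_le, ?_⟩
    by_contra h
    exact hx (by simp [hζ x (not_le.1 h)])

theorem Hpart_mulVec_restrictTo {n : ℕ} {η : 𝔾 → ℂ} (hη : ∀ x, n < D.shell x → η x = 0) :
    D.Hpart 0 n *ᵥ D.restrictTo n η = D.restrictTo n (D.act η) := by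
  ext x
  rw [restrictTo, act, finsum_eq_sum_of_support_subset (s := (Finset.univ : Finset (D.G 0 n)).map
    (Function.Embedding.subtype _)), Finset.sum_map]
  · rfl
  · intro y hy
    have : D.shell y ≤ n := by
      by_contra h
      exact hy (by simp [hη y (not_le.1 h)])
    simp [this]

namespace Channels

variable {D} (c : D.Channels)

theorem embΦ_conjTranspose_mulVec_restrictTo {n : ℕ} {η : 𝔾 → ℂ}
    (hη : ∀ x, n ≤ D.shell x → η x = 0) : (c.embΦ 0 n)ᴴ *ᵥ D.restrictTo n η = 0 := by
  ext j
  simp only [mulVec, dotProduct, Pi.zero_apply]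
  refine Finset.sum_eq_zero fun x _ => ?_
  by_cases hx : D.shell x.1 = n
  · simp [restrictTo, hη x.1 hx.ge]
  · simp [embΦ, conjTranspose_apply, hx]

theorem root_eq_zero {x : 𝔾} (hx : 0 < D.shell x) : c.root x = 0 :=
  dif_neg hx.ne'

/-- The function `m_n(z) = Υ_0^* (H_{0,n} - i Φ_n Φ_n^* - z)⁻¹ Υ_0`. -/
def truncatedM (n : ℕ) (z : ℂ) : ℂ :=
  dissipativeM (D.Hpart 0 n) (c.embΦ 0 n) (D.restrictTo n c.root) z

theorem isHermitian_Hpart (m n : ℕ) : (D.Hpart m n).IsHermitian :=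
  D.hermitian.submatrix _

/-- The solution `ψ` of `(H - z) ψ = Υ_0` is approximated in graph norm by a finitely supported `η`.
For large `n` the dissipative truncation acts on `η` exactly as `H` does, so `η` solves the
truncated equation up to a small `ξ`, and the truncated resolvent is bounded by `1 / Im z` uniformly
in `n`. -/
theorem tendsto_truncatedM (hsa : D.SelfAdjointWithNaturalDomain) {z : ℂ} (hz : 0 < z.im)
    {ψ : D.Hmin.closure.domain}
    (hψ : D.Hmin.closure ψ - z • (ψ : HilbertSpace 𝔾) = c.root) :
    Tendsto (fun n => c.truncatedM n z) atTop (𝓝 (inner ℂ c.root (ψ : HilbertSpace 𝔾))) := by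
  refine Metric.tendsto_atTop.2 fun e he => ?_
  set k : ℝ := ‖c.root‖ * (1 + (1 + ‖z‖) / z.im) + 1 with hk
  have hkpos : 0 < k := by positivity
  set d := e / k with hd
  have hdpos : 0 < d := div_pos he hkpos
  obtain ⟨η, hη1, hη2⟩ := IsSelfAdjoint.exists_approx hsa ψ hdpos
  obtain ⟨N, hN⟩ : ∃ N, ∀ x, N < D.shell x → (η : HilbertSpace 𝔾) x = 0 := by
    have hfin : {x | (η : HilbertSpace 𝔾) x ≠ 0}.Finite := η.2
    obtain ⟨N, hN⟩ := (hfin.image D.shell).bddAbove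
    refine ⟨N, fun x hx => ?_⟩
    by_contra h
    exact absurd (hN ⟨x, h, rfl⟩) (not_le.2 hx)
  set ξ : HilbertSpace 𝔾 := D.Hmin η - z • (η : HilbertSpace 𝔾) - c.root with hξ
  have hξn : ‖ξ‖ ≤ d * (1 + ‖z‖) := by
    have : ξ = (D.Hmin η - D.Hmin.closure ψ) - z • ((η : HilbertSpace 𝔾) - ψ) := by
      rw [hξ, ← hψ, smul_sub]; abel
    rw [this]
    refine (norm_sub_le _ _).trans ?_
    rw [norm_smul]
    nlinarith [norm_nonneg z]
  -- For `n ≥ N + 1` the vector `η` vanishes on the shell `n` itself, which carries `Φ_n`.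
  refine ⟨N + 1, fun n hn => ?_⟩
  have hH := isHermitian_Hpart (D := D) 0 n
  have hu := isUnit_det_dissipative hH (c.embΦ 0 n) hz
  set M := dissipative (D.Hpart 0 n) (c.embΦ 0 n) - z • 1 with hM
  have hMη : M *ᵥ D.restrictTo n (η : HilbertSpace 𝔾) =
      D.restrictTo n c.root + D.restrictTo n ξ := by
    have h1 := D.Hpart_mulVec_restrictTo (n := n) (η := (η : HilbertSpace 𝔾))
      fun x hx => hN x (by omega)
    have h2 := c.embΦ_conjTranspose_mulVec_restrictTo (n := n) (η := (η : HilbertSpace 𝔾))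
      fun x hx => hN x (by omega)
    rw [hM, dissipative, sub_mulVec, sub_mulVec, smul_mulVec, smul_mulVec, ← mulVec_mulVec, h2,
      mulVec_zero, smul_zero, sub_zero, one_mulVec, h1]
    ext x
    change D.act (η : HilbertSpace 𝔾) x.1 - z * (η : HilbertSpace 𝔾) x.1 = c.root x.1 +
      (D.act (η : HilbertSpace 𝔾) x.1 - z * (η : HilbertSpace 𝔾) x.1 - c.root x.1)
    ring
  have hMinv : M⁻¹ *ᵥ D.restrictTo n c.root =
      D.restrictTo n (η : HilbertSpace 𝔾) - M⁻¹ *ᵥ D.restrictTo n ξ := by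
    rw [eq_sub_iff_add_eq, ← mulVec_add, ← hMη, mulVec_mulVec, Matrix.nonsing_inv_mul _ hu,
      one_mulVec]
  have hval : c.truncatedM n z - inner ℂ c.root (ψ : HilbertSpace 𝔾) =
      inner ℂ c.root ((η : HilbertSpace 𝔾) - ψ) -
        star (D.restrictTo n c.root) ⬝ᵥ (M⁻¹ *ᵥ D.restrictTo n ξ) := by
    rw [truncatedM, dissipativeM, ← hM, hMinv, dotProduct_sub, D.star_restrictTo_dotProduct
      (fun x hx => c.root_eq_zero (by omega)), inner_sub_right]
    ring
  rw [dist_eq_norm, hval]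
  have e1 : ‖inner ℂ c.root ((η : HilbertSpace 𝔾) - ψ)‖ ≤ ‖c.root‖ * d :=
    (norm_inner_le_norm _ _).trans (mul_le_mul_of_nonneg_left hη1.le (norm_nonneg _))
  have e2 : ‖star (D.restrictTo n c.root) ⬝ᵥ (M⁻¹ *ᵥ D.restrictTo n ξ)‖ ≤
      ‖c.root‖ * (d * (1 + ‖z‖) / z.im) := by
    rw [star_dotProduct_eq_inner]
    refine (norm_inner_le_norm _ _).trans (mul_le_mul (D.norm_restrictTo_le n _) ?_
      (norm_nonneg _) (norm_nonneg _))
    refine (norm_inv_dissipative_mulVec_le hH _ _ hz).trans ?_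
    gcongr
    exact (D.norm_restrictTo_le n ξ).trans hξn
  calc _ ≤ ‖c.root‖ * d + ‖c.root‖ * (d * (1 + ‖z‖) / z.im) :=
        (norm_sub_le _ _).trans (add_le_add e1 e2)
    _ = d * (k - 1) := by rw [hk]; ring
    _ < d * k := by nlinarith
    _ = e := by rw [hd]; field_simp

end Channels

end ShellOperator

theorem IsHerglotz.mono {m : ℂ → ℂ} {C C' : ℝ} (hm : IsHerglotz m C) (h : C ≤ C') :
    IsHerglotz m C' where
  differentiableAt := hm.differentiableAt
  im_nonneg := hm.im_nonneg
  norm_le z hz := (hm.norm_le z hz).trans (by gcongr)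

/-! ### Extended integrals -/

/-- The integrable minorant makes the integral of the negative part of `f` finite, so the case `∞ -
∞` does not arise. -/
theorem le_extIntegral {K : Set ℝ} {f g : ℝ → ℝ} (hg : IntegrableOn g K)
    (hfg : ∀ᵐ t ∂(volume.restrict K), g t ≤ f t) :
    ((∫ t in K, g t : ℝ) : EReal) ≤ extIntegral K f := by
  have hp : ∫⁻ t in K, ENNReal.ofReal (g t) ≠ ⊤ := hg.lintegral_lt_top.ne
  have hn : ∫⁻ t in K, ENNReal.ofReal (-g t) ≠ ⊤ := hg.neg.lintegral_lt_top.ne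
  rw [integral_eq_lintegral_pos_part_sub_lintegral_neg_part hg, EReal.coe_sub,
    EReal.coe_ennreal_toReal hp, EReal.coe_ennreal_toReal hn, extIntegral]
  refine EReal.sub_le_sub ?_ ?_
  · exact EReal.coe_ennreal_le_coe_ennreal_iff.2
      (lintegral_mono_ae (hfg.mono fun t ht => ENNReal.ofReal_le_ofReal ht))
  · exact EReal.coe_ennreal_le_coe_ennreal_iff.2
      (lintegral_mono_ae (hfg.mono fun t ht => ENNReal.ofReal_le_ofReal (neg_le_neg ht)))

/-- Apply `log x ≤ x - 1` to `x = s / (f² w)` and to `x = w⁻¹`, multiply by `w` and add. The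
parameter `s` is free: it is taken large when the integral of `ρ` is small, so that `w log s`
dominates. -/
theorem log_mul_mul_ge {f w ρ s : ℝ} (hf : 0 < f) (hw : 0 < w) (hs : 0 < s)
    (hρ : 1 ≤ ρ * f ^ 2) :
    (w * (1 + Real.log s) - s * ρ - 1) / 2 ≤ Real.log (f * w) * w := by
  have h1 : Real.log (s / (f ^ 2 * w)) ≤ s / (f ^ 2 * w) - 1 :=
    Real.log_le_sub_one_of_pos (by positivity)
  rw [Real.log_div hs.ne' (by positivity), Real.log_mul (by positivity) hw.ne', Real.log_pow] at h1
  have h2 : Real.log w⁻¹ ≤ w⁻¹ - 1 := Real.log_le_sub_one_of_pos (by positivity)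
  rw [Real.log_inv] at h2
  rw [Real.log_mul hf.ne' hw.ne']
  have h3 : w * (s / (f ^ 2 * w)) ≤ s * ρ := by
    have : w * (s / (f ^ 2 * w)) = s / f ^ 2 := by field_simp
    rw [this, div_le_iff₀ (by positivity), mul_assoc]
    exact le_mul_of_one_le_right hs.le hρ
  have h4 := mul_le_mul_of_nonneg_left h1 hw.le
  have h5 := mul_le_mul_of_nonneg_left h2 hw.le
  have h6 : w * w⁻¹ = 1 := mul_inv_cancel₀ hw.ne'
  push_cast at h4
  nlinarith

/-! ### Boundary densities of the truncations and the two criteria -/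

namespace ShellOperator

variable {𝔾 : Type*} {D : ShellOperator 𝔾}

namespace Channels

variable (c : D.Channels)

/-- The boundary density `Im m_n` on the real line. -/
def density (n : ℕ) (t : ℝ) : ℝ := (c.truncatedM n t).im

theorem measurable_density (n : ℕ) : Measurable (c.density n) :=
  Complex.measurable_im.comp ((measurable_dissipativeM _ _ _).comp Complex.measurable_ofReal)

theorem isHerglotz_truncatedM (n : ℕ) : IsHerglotz (c.truncatedM n) (‖c.root‖ ^ 2) :=
  (isHerglotz_dissipativeM (isHermitian_Hpart 0 n) _ _).mono
    (pow_le_pow_left₀ (norm_nonneg _) (D.norm_restrictTo_le n c.root) 2)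

theorem β_mulVec_apply (n : ℕ) (z : ℂ) (B : Fin (D.r (n + 1)) → ℂ) :
    (c.β 0 n z *ᵥ B) (0 : Fin 1) =
      (star (D.restrictTo n c.root) ᵥ* ((D.Hpart 0 n - z • 1)⁻¹ * c.embΦ 0 n)) ⬝ᵥ B := by
  have hβ : c.β 0 n z = (c.embΥ 0 n)ᴴ * ((D.Hpart 0 n - z • 1)⁻¹ * c.embΦ 0 n) := by
    rw [β, R, conjTranspose_fromCols_eq_fromRows_conjTranspose, fromRows_mul,
      fromRows_mul_fromCols, toBlocks_fromBlocks₁₂, Matrix.mul_assoc]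
  rw [hβ]
  rfl

theorem δ_eq (n : ℕ) (z : ℂ) :
    c.δ 0 n z = (c.embΦ 0 n)ᴴ * (D.Hpart 0 n - z • 1)⁻¹ * c.embΦ 0 n := by
  rw [δ, R, conjTranspose_fromCols_eq_fromRows_conjTranspose, fromRows_mul,
    fromRows_mul_fromCols, toBlocks_fromBlocks₂₂]

/-- The vector `T (1, 0)ᵀ` consists of the single column `B` (as `r_0 = 1`) and `δ B`, exactly the
two terms in the Cauchy-Schwarz bound, while `β B = 1` is its hypothesis. -/
theorem one_le_density_mul {n : ℕ} {t : ℝ} (ht : (D.Hpart 0 n - (t : ℂ) • 1).det ≠ 0)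
    {T : Matrix (Fin (D.r (n + 1)) ⊕ Fin (D.r (n + 1))) (Fin (D.r 0) ⊕ Fin (D.r 0)) ℂ}
    (hT : T ∈ c.transferSet 0 n (t : ℂ)) : 1 ≤ c.density n t * D.normDirichlet T ^ 2 := by
  obtain ⟨B, b, hB, -, rfl⟩ := hT
  set v : Fin (D.r (n + 1)) → ℂ := B *ᵥ fun _ => 1 with hv
  have h1 : (star (D.restrictTo n c.root) ᵥ* ((D.Hpart 0 n - (t : ℂ) • 1)⁻¹ * c.embΦ 0 n)) ⬝ᵥ v
      = 1 := by
    rw [← c.β_mulVec_apply, hv, mulVec_mulVec, hB, one_mulVec]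
  have h2 := one_le_im_dissipativeM_mul (isHermitian_Hpart 0 n) (c.embΦ 0 n) _ ht h1
  have h3 : D.normDirichlet (fromBlocks B (-b) (c.δ 0 n t * B) (c.γ 0 n t - c.δ 0 n t * b)) ^ 2 =
      ‖WithLp.toLp 2 v‖ ^ 2 + ‖WithLp.toLp 2 (c.δ 0 n t *ᵥ v)‖ ^ 2 := by
    rw [normDirichlet, fromBlocks_mulVec, EuclideanSpace.norm_sq_eq, EuclideanSpace.norm_sq_eq,
      EuclideanSpace.norm_sq_eq, Fintype.sum_sum_type]
    have e1 : ∀ M : Matrix (Fin (D.r (n + 1))) (Fin (D.r 0)) ℂ,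
        M *ᵥ (fun _ => (0 : ℂ)) = 0 := fun M => mulVec_zero M
    simp [Function.comp_def, e1, hv, mulVec_mulVec]
  rw [h3, δ_eq]
  exact h2

theorem ae_tendsto_density (n : ℕ) : ∀ᵐ t : ℝ,
    Tendsto (fun ε : ℝ => (c.truncatedM n (t + ε * Complex.I)).im) (𝓝[>] 0)
      (𝓝 (c.density n t)) :=
  (ae_det_sub_smul_ne_zero (D.Hpart 0 n)).mono fun _ ht =>
    tendsto_im_dissipativeM (isHermitian_Hpart 0 n) _ _ ht

theorem ae_one_le_density_mul {a b : ℝ} {n : ℕ}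
    {T : ℝ → Matrix (Fin (D.r (n + 1)) ⊕ Fin (D.r (n + 1))) (Fin (D.r 0) ⊕ Fin (D.r 0)) ℂ}
    (hT : c.IsMeasurableChoice a b n T) : ∀ᵐ t ∂(volume.restrict (Set.Ioo a b)),
      1 ≤ c.density n t * D.normDirichlet (T t) ^ 2 := by
  filter_upwards [hT.2, ae_restrict_of_ae (ae_det_sub_smul_ne_zero (D.Hpart 0 n))] with t h1 h2
  exact c.one_le_density_mul h2 h1

theorem isSelfAdjoint_H (hsa : D.SelfAdjointWithNaturalDomain) : IsSelfAdjoint D.H := by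
  have h : D.H = D.Hmin.closure := IsSelfAdjoint.adjoint_eq_closure hsa
  rw [h]
  exact hsa

theorem isSpectralMeasure_μ (hsa : D.SelfAdjointWithNaturalDomain) :
    IsSpectralMeasure D.H c.root c.μ :=
  isSpectralMeasure_spectralMeasure (isSelfAdjoint_H hsa) c.root

theorem tendsto_lintegral_density (hsa : D.SelfAdjointWithNaturalDomain) {K : Set ℝ}
    (hK : IsCompact K) (hμK : c.μ K = 0) :
    Tendsto (fun n => ∫⁻ t in K, ENNReal.ofReal (c.density n t)) atTop (𝓝 0) := by
  have hμ := c.isSpectralMeasure_μ hsa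
  have hfin := hμ.1
  refine tendsto_lintegral_boundary_zero (sq_nonneg ‖c.root‖) c.isHerglotz_truncatedM c.μ
    (fun z hz => ?_) c.ae_tendsto_density hK hμK
  have h : D.H = D.Hmin.closure := IsSelfAdjoint.adjoint_eq_closure hsa
  rw [h] at hμ
  obtain ⟨ψ, h1, h2⟩ := hμ.2 z hz.ne'
  rw [stieltjesTransform, ← h2]
  exact c.tendsto_truncatedM hsa hz h1

/-- If the solutions stay bounded along a subsequence, then compact sets of positive Lebesgue
measure have positive spectral measure. -/
theorem μ_ne_zero_of_bddAbove (hsa : D.SelfAdjointWithNaturalDomain) {a b : ℝ} {nk : ℕ → ℕ}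
    {T : ∀ k, ℝ → Matrix (Fin (D.r (nk k + 1)) ⊕ Fin (D.r (nk k + 1)))
      (Fin (D.r 0) ⊕ Fin (D.r 0)) ℂ} (hnk : StrictMono nk)
    (hT : ∀ k, c.IsMeasurableChoice a b (nk k) (T k))
    (hbdd : ∀ᵐ t ∂(volume.restrict (Set.Ioo a b)),
      BddAbove (Set.range fun k => D.normDirichlet (T k t)))
    {K : Set ℝ} (hK : IsCompact K) (hKab : K ⊆ Set.Ioo a b) (hKpos : 0 < volume K) :
    c.μ K ≠ 0 := by
  intro h0
  have hlim := (c.tendsto_lintegral_density hsa hK h0).comp hnk.tendsto_atTop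
  have hmeas : ∀ k, Measurable fun t => ENNReal.ofReal (c.density (nk k) t) := fun k =>
    (c.measurable_density (nk k)).ennreal_ofReal
  -- Fatou's lemma makes the lower limit of the densities vanish almost everywhere on `K`, whereas a
  -- bound `M` on the solutions at `t` keeps every density above `1 / (M ^ 2 + 1)`.
  have hfatou : ∫⁻ t in K, liminf (fun k => ENNReal.ofReal (c.density (nk k) t)) atTop = 0 := by
    have h := lintegral_liminf_le (μ := volume.restrict K) (u := atTop) hmeas
    exact le_antisymm (h.trans hlim.liminf_eq.le) zero_le
  rw [lintegral_eq_zero_iff (Measurable.liminf hmeas)] at hfatou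
  have hle := Measure.restrict_mono hKab (le_refl (volume : Measure ℝ))
  have hall : ∀ᵐ t ∂(volume.restrict K), ∀ k,
      1 ≤ c.density (nk k) t * D.normDirichlet (T k t) ^ 2 :=
    ae_all_iff.2 fun k => ae_mono hle (c.ae_one_le_density_mul (hT k))
  have hfalse : ∀ᵐ t ∂(volume.restrict K), False := by
    filter_upwards [hfatou, hall, ae_mono hle hbdd] with t h1 h2 ⟨M, hM⟩
    have hbound : ∀ k, ENNReal.ofReal (1 / (M ^ 2 + 1)) ≤ ENNReal.ofReal (c.density (nk k) t) := by
      intro k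
      refine ENNReal.ofReal_le_ofReal ?_
      have hf0 : 0 ≤ D.normDirichlet (T k t) := norm_nonneg _
      have hfM : D.normDirichlet (T k t) ≤ M := hM ⟨k, rfl⟩
      have hd : 0 < c.density (nk k) t := by
        by_contra h
        nlinarith [h2 k, sq_nonneg (D.normDirichlet (T k t))]
      rw [div_le_iff₀ (by positivity)]
      nlinarith [h2 k, mul_le_mul_of_nonneg_left (pow_le_pow_left₀ hf0 hfM 2) hd.le]
    have hge : ENNReal.ofReal (1 / (M ^ 2 + 1)) ≤
        liminf (fun k => ENNReal.ofReal (c.density (nk k) t)) atTop :=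
      le_liminf_of_le (by isBoundedDefault) (Eventually.of_forall hbound)
    rw [h1] at hge
    have : 0 < ENNReal.ofReal (1 / (M ^ 2 + 1)) := ENNReal.ofReal_pos.2 (by positivity)
    exact absurd hge (not_le.2 this)
  rw [ae_iff] at hfalse
  simp only [not_false_eq_true, Set.ofPred_true, Measure.restrict_apply_univ] at hfalse
  exact hKpos.ne' hfalse

/-- Finiteness of the logarithmic integrals implies that compact sets of positive Lebesgue measure
have positive spectral measure. -/
theorem μ_ne_zero_of_liminf_extIntegral (hsa : D.SelfAdjointWithNaturalDomain) {a b : ℝ}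
    {w : ℝ → ℝ} {T : ∀ n, ℝ → Matrix (Fin (D.r (n + 1)) ⊕ Fin (D.r (n + 1)))
      (Fin (D.r 0) ⊕ Fin (D.r 0)) ℂ}
    (hw : LocallyIntegrableOn w (Set.Ioo a b))
    (hwpos : ∀ᵐ t ∂(volume.restrict (Set.Ioo a b)), 0 < w t)
    (hT : ∀ n, c.IsMeasurableChoice a b n (T n))
    {K : Set ℝ} (hK : IsCompact K) (hKab : K ⊆ Set.Ioo a b) (hKpos : 0 < volume K)
    (hlim : liminf (fun n => extIntegral K
      (fun t => Real.log (D.normDirichlet (T n t) * w t) * w t)) atTop < ⊤) :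
    c.μ K ≠ 0 := by
  intro h0
  have hI := c.tendsto_lintegral_density hsa hK h0
  have hwK : IntegrableOn w K := hw.integrableOn_compact_subset hKab hK
  have hle := Measure.restrict_mono hKab (le_refl (volume : Measure ℝ))
  have hwposK : ∀ᵐ t ∂(volume.restrict K), 0 < w t := ae_mono hle hwpos
  have hKfin : volume K ≠ ⊤ := hK.measure_lt_top.ne
  have hW : 0 < ∫ t in K, w t := by
    rw [integral_pos_iff_support_of_nonneg_ae (hwposK.mono fun t ht => ht.le) hwK]
    have : (volume.restrict K) (Function.support w) = (volume.restrict K) Set.univ := by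
      refine measure_congr ?_
      filter_upwards [hwposK] with t ht
      exact propext ⟨fun _ => trivial, fun _ => ht.ne'⟩
    rw [this, Measure.restrict_apply_univ]
    exact hKpos
  refine hlim.ne (EReal.eq_top_iff_forall_lt _ |>.2 fun L => ?_)
  set W := ∫ t in K, w t with hWdef
  -- Chosen so that `W log s` is `2 (L + 1)` plus the losses: at most `1` from `s ∫ ρ`, and `volume
  -- K` from the constant term. Aiming at `L + 1` leaves room for the strict inequality with `L`.
  set s : ℝ := Real.exp ((2 * (L + 1) + 1 + volume.real K) / W) with hs
  have hspos : 0 < s := Real.exp_pos _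
  have hsmall : ∀ᶠ n in atTop, ∫⁻ t in K, ENNReal.ofReal (c.density n t) < ENNReal.ofReal s⁻¹ :=
    hI.eventually (gt_mem_nhds (ENNReal.ofReal_pos.2 (by positivity)))
  have hev : ∀ᶠ n in atTop, ((L + 1 : ℝ) : EReal) ≤ extIntegral K
      (fun t => Real.log (D.normDirichlet (T n t) * w t) * w t) := by
    filter_upwards [hsmall] with n hn
    have hdn := ae_mono hle (c.ae_one_le_density_mul (hT n))
    have hdpos : ∀ᵐ t ∂(volume.restrict K), 0 < c.density n t := by
      filter_upwards [hdn] with t ht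
      by_contra h
      nlinarith [sq_nonneg (D.normDirichlet (T n t))]
    have hρi : IntegrableOn (c.density n) K := by
      refine ⟨(c.measurable_density n).aestronglyMeasurable, ?_⟩
      rw [hasFiniteIntegral_iff_ofReal (hdpos.mono fun t ht => ht.le)]
      exact hn.trans ENNReal.ofReal_lt_top
    have hρ1 : ∫ t in K, c.density n t ≤ s⁻¹ := by
      rw [integral_eq_lintegral_of_nonneg_ae (hdpos.mono fun t ht => ht.le)
        (c.measurable_density n).aestronglyMeasurable]
      exact ENNReal.toReal_le_of_le_ofReal (by positivity) hn.le
    have hgi : IntegrableOn (fun t => (w t * (1 + Real.log s) - s * c.density n t - 1) / 2) K :=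
      (((hwK.mul_const _).sub (hρi.const_mul s)).sub (integrableOn_const hKfin)).div_const 2
    refine le_trans ?_ (le_extIntegral hgi ?_)
    · have hwi : Integrable (fun t => w t * (1 + Real.log s)) (volume.restrict K) :=
        hwK.mul_const _
      have hsi : Integrable (fun t => s * c.density n t) (volume.restrict K) := hρi.const_mul s
      have hwsi : Integrable (fun t => w t * (1 + Real.log s) - s * c.density n t)
        (volume.restrict K) := hwi.sub hsi
      rw [EReal.coe_le_coe_iff, integral_div, integral_sub hwsi (integrableOn_const hKfin),
        integral_sub hwi hsi, integral_mul_const, integral_const_mul, setIntegral_const,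
        smul_eq_mul, mul_one, ← hWdef]
      have hlog : Real.log s = (2 * (L + 1) + 1 + volume.real K) / W := Real.log_exp _
      rw [hlog]
      have h1 : s * ∫ t in K, c.density n t ≤ 1 := by
        calc _ ≤ s * s⁻¹ := by gcongr
          _ = 1 := mul_inv_cancel₀ hspos.ne'
      have h2 : W * ((2 * (L + 1) + 1 + volume.real K) / W) = 2 * (L + 1) + 1 + volume.real K := by
        field_simp
      nlinarith
    · filter_upwards [hdn, hwposK] with t h1 h2
      have hf : 0 < D.normDirichlet (T n t) := by
        refine (norm_nonneg _).lt_of_ne fun h => ?_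
        have h3 : D.normDirichlet (T n t) = 0 := h.symm
        rw [h3] at h1
        norm_num at h1
      exact log_mul_mul_ge hf h2 hspos h1
  exact lt_of_lt_of_le (EReal.coe_lt_coe_iff.2 (lt_add_one L))
    (le_liminf_of_le (by isBoundedDefault) hev)

end Channels

end ShellOperator

end

theorem mainTheorem3 {𝔾 : Type*} (D : ShellOperator 𝔾) (c : D.Channels)
    (hsa : D.SelfAdjointWithNaturalDomain) (hA1 : D.RankMonotone) (hA2 : c.FullRank)
    (a b : ℝ) (hab : a < b) :
    (∀ (nk : ℕ → ℕ) (T : ∀ k, ℝ → Matrix (Fin (D.r (nk k + 1)) ⊕ Fin (D.r (nk k + 1)))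
          (Fin (D.r 0) ⊕ Fin (D.r 0)) ℂ),
        StrictMono nk →
        (∀ k, c.IsMeasurableChoice a b (nk k) (T k)) →
        (∀ᵐ t ∂(volume.restrict (Set.Ioo a b)),
          BddAbove (Set.range fun k => D.normDirichlet (T k t))) →
        Set.Icc a b ⊆ (acPart c.μ).support ∧ (acPart c.μ).support ⊆ acSpectrum D.H) ∧
    (∀ (w : ℝ → ℝ) (T : ∀ n, ℝ → Matrix (Fin (D.r (n + 1)) ⊕ Fin (D.r (n + 1)))
          (Fin (D.r 0) ⊕ Fin (D.r 0)) ℂ),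
        LocallyIntegrableOn w (Set.Ioo a b) →
        (∀ᵐ t ∂(volume.restrict (Set.Ioo a b)), 0 < w t) →
        (∀ n, c.IsMeasurableChoice a b n (T n)) →
        (∀ K : Set ℝ, IsCompact K → K ⊆ Set.Ioo a b → 0 < volume K →
          liminf (fun n => extIntegral K
            (fun t => Real.log (D.normDirichlet (T n t) * w t) * w t)) atTop < ⊤) →
        Set.Icc a b ⊆ (acPart c.μ).support ∧ (acPart c.μ).support ⊆ acSpectrum D.H) := by
  have hfin := (c.isSpectralMeasure_μ hsa).1
  have hsub : (acPart c.μ).support ⊆ acSpectrum D.H :=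
    support_acPart_spectralMeasure_subset (ShellOperator.Channels.isSelfAdjoint_H hsa) c.root
  refine ⟨fun nk T hnk hT hbdd => ⟨Icc_subset_support_acPart c.μ hab fun K hK hKab hKpos =>
    c.μ_ne_zero_of_bddAbove hsa hnk hT hbdd hK hKab hKpos, hsub⟩,
    fun w T hw hwpos hT hlim => ⟨Icc_subset_support_acPart c.μ hab fun K hK hKab hKpos =>
    c.μ_ne_zero_of_liminf_extIntegral hsa hw hwpos hT hK hKab hKpos (hlim K hK hKab hKpos), hsub⟩⟩
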